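/- Let $A$ and $B$ be (possibly unbounded) self-adjoint operators in a complex Hilbert space $\mathcal H$ with domains $\mathcal D(A)$, $\mathcal D(B)$, and let $J$ be a bounded operator on $\mathcal H$. Let $E_\lambda$ be the spectral projectors of $B$, let $P_{ac}(B)$ be the orthogonal projection onto the absolutely continuous subspace of $B$ (the set of all $\varphi\in\mathcal H$ whose spectral measure $d(\varphi,E_\lambda\varphi)$ is absolutely continuous with respect to Lebesgue measure), and let $\mathcal M(B)$ be the set of all $\varphi\in\mathcal H$ such that $d(\varphi,E_\lambda\varphi)=|f(\lambda)|^2\,d\lambda$ for some $f\in L^\infty(\mathbb R)$. Suppose that $C=AJ-JB$ in the form sense, i.e. $C$ is an operator on $\mathcal H$ with $$(\varphi,C\psi)=(A\varphi,J\psi)-(\varphi,JB\psi)\qquad\text{for all }\varphi\in\mathcal D(A),\ \psi\in\mathcal D(B),$$ and that $C=C_1+C_2$, where $C_1$ is a trace class operator and $C_2$ is a bounded operator on $\mathcal H$. Suppose further that there is a subset $M\subset\mathcal M(B)$, dense in $\mathcal M(B)$ in the norm of $\mathcal H$, such that for every $\varphi\in M$ $$\lim_{t\to+\infty}C_2e^{-iBt}\varphi=0\qquad\text{and}\qquad\int_0^{+\infty}\|C_2e^{-iBt}\varphi\|\,dt<\infty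 .$$ Then the strong limit $$\Omega_{out}(A,B;J)=\operatorname*{s-lim}_{t\to+\infty}e^{iAt}Je^{-iBt}P_{ac}(B)$$ exists as a bounded operator on $\mathcal H$, i.e. $e^{iAt}Je^{-iBt}P_{ac}(B)\varphi$ converges in norm as $t\to+\infty$ for every $\varphi\in\mathcal H$. -/

import Mathlib

open MeasureTheory Filter Topology Set
open scoped InnerProductSpace ENNReal

noncomputable section

namespace Scattering

variable {H : Type*} [NormedAddCommGroup H] [InnerProductSpace ℂ H] [CompleteSpace H]

/-! ### Trace class operators -/

/-- `T` is trace class: `tr |T| < ∞`, where `|T| = (T* T)^(1/2)` and the trace (a sum of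
nonnegative terms that does not depend on the basis) is computed in an orthonormal basis. -/
def IsTraceClass (T : H →L[ℂ] H) : Prop :=
  ∃ (w : Set H) (b : HilbertBasis w ℂ H), Summable fun i => (⟪b i, CFC.abs T (b i)⟫_ℂ).re

/-! ### The unitary group of a self-adjoint operator -/

/-- `U` is the strongly continuous one-parameter unitary group `t ↦ e^{itB}`: its generator is
`iB`, that is, `φ ∈ D(B)` and `B φ = ψ` if and only if `t ↦ U t φ` has derivative `i ψ` at `0`. -/
structure IsUnitaryGroupOf (B : H →ₗ.[ℂ] H) (U : ℝ → H →L[ℂ] H) : Prop where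
  mem_unitary : ∀ t, U t ∈ unitary (H →L[ℂ] H)
  map_zero : U 0 = 1
  map_add : ∀ s t, U (s + t) = U s * U t
  continuous : ∀ φ, Continuous fun t => U t φ
  generator : ∀ φ ψ : H,
    (φ, ψ) ∈ B.graph ↔ HasDerivAt (fun t => U t φ) (Complex.I • ψ) 0

open Classical in
/-- The operator `e^{itB}`, for self-adjoint `B`. By Stone's theorem there is exactly one group as
in `IsUnitaryGroupOf` for every self-adjoint `B`, so the second branch does not occur then. -/
def expI (B : H →ₗ.[ℂ] H) (t : ℝ) : H →L[ℂ] H :=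
  if h : ∃ U : ℝ → H →L[ℂ] H, IsUnitaryGroupOf B U then h.choose t else 1

/-! ### Projection-valued measures and the spectral measure of a self-adjoint operator -/

/-- A projection-valued measure on the Borel sets of `ℝ`: orthogonal projections, countably
additive in the strong sense, of total mass `1`. -/
structure ProjMeasure (H : Type*) [NormedAddCommGroup H] [InnerProductSpace ℂ H]
    [CompleteSpace H] where
  proj : Set ℝ → H →L[ℂ] H
  isStarProjection : ∀ S, MeasurableSet S → IsStarProjection (proj S)
  not_measurable : ∀ S, ¬ MeasurableSet S → proj S = 0
  empty : proj ∅ = 0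
  univ : proj Set.univ = 1
  hasSum_iUnion : ∀ S : ℕ → Set ℝ, (∀ n, MeasurableSet (S n)) →
    Pairwise (Function.onFun Disjoint S) → ∀ φ : H,
      HasSum (fun n => proj (S n) φ) (proj (⋃ n, S n) φ)

namespace ProjMeasure

theorem inner_proj (E : ProjMeasure H) {S : Set ℝ} (hS : MeasurableSet S) (φ : H) :
    (⟪φ, E.proj S φ⟫_ℂ).re = ‖E.proj S φ‖ ^ 2 := by
  have h := E.isStarProjection S hS
  have h1 : E.proj S (E.proj S φ) = E.proj S φ :=
    congrArg (fun T : H →L[ℂ] H => T φ) h.isIdempotentElem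
  have h2 : ContinuousLinearMap.adjoint (E.proj S) = E.proj S := h.isSelfAdjoint
  have h3 : ⟪φ, E.proj S φ⟫_ℂ = ⟪E.proj S φ, E.proj S φ⟫_ℂ := by
    conv_lhs => rw [← h1, ← ContinuousLinearMap.adjoint_inner_left, h2]
  rw [h3, inner_self_eq_norm_sq_to_K]
  norm_cast

/-- The measure `d(φ, E_λ φ)`, that is, `S ↦ (φ, E(S) φ)`. -/
def scalar (E : ProjMeasure H) (φ : H) : Measure ℝ :=
  Measure.ofMeasurable (fun S _ => ENNReal.ofReal (⟪φ, E.proj S φ⟫_ℂ).re)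
    (by simp [E.empty])
    (by
      intro S hS hd
      have h := E.hasSum_iUnion S hS hd φ
      have h' : HasSum (fun n => (⟪φ, E.proj (S n) φ⟫_ℂ).re)
          (⟪φ, E.proj (⋃ n, S n) φ⟫_ℂ).re :=
        h.mapL ((Complex.reCLM).comp ((innerSL ℂ φ).restrictScalars ℝ))
      rw [← h'.tsum_eq, ENNReal.ofReal_tsum_of_nonneg _ h'.summable]
      intro n
      rw [E.inner_proj (hS n)]
      positivity)

theorem scalar_apply (E : ProjMeasure H) (φ : H) {S : Set ℝ} (hS : MeasurableSet S) :
    E.scalar φ S = ENNReal.ofReal (⟪φ, E.proj S φ⟫_ℂ).re :=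
  Measure.ofMeasurable_apply S hS

theorem scalar_apply_eq_zero (E : ProjMeasure H) (φ : H) {S : Set ℝ} (hS : MeasurableSet S) :
    E.scalar φ S = 0 ↔ E.proj S φ = 0 := by
  rw [E.scalar_apply φ hS, E.inner_proj hS, ENNReal.ofReal_eq_zero]
  constructor
  · intro h
    have : ‖E.proj S φ‖ = 0 := by nlinarith [norm_nonneg (E.proj S φ)]
    simpa using this
  · intro h
    simp [h]

theorem scalar_ac_iff (E : ProjMeasure H) (φ : H) :
    E.scalar φ ≪ volume ↔
      ∀ S, MeasurableSet S → volume S = 0 → E.proj S φ = 0 := by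
  constructor
  · intro h S hS h0
    exact (E.scalar_apply_eq_zero φ hS).1 (h h0)
  · intro h
    refine Measure.AbsolutelyContinuous.mk fun S hS h0 => ?_
    exact (E.scalar_apply_eq_zero φ hS).2 (h S hS h0)

open Classical in
/-- The point mass at `0`: the spectral measure of the zero operator. -/
instance : Inhabited (ProjMeasure H) where
  default :=
    { proj := fun S => if MeasurableSet S ∧ (0 : ℝ) ∈ S then 1 else 0
      isStarProjection := by
        intro S _
        split_ifs
        · exact IsStarProjection.one _
        · exact IsStarProjection.zero _
      not_measurable := by
        intro S hS
        simp [hS]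
      empty := by simp
      univ := by simp
      hasSum_iUnion := by
        intro S hS hd φ
        by_cases h : ∃ n, (0 : ℝ) ∈ S n
        · obtain ⟨n, hn⟩ := h
          have hU : (0 : ℝ) ∈ ⋃ k, S k := mem_iUnion.2 ⟨n, hn⟩
          have hS' : MeasurableSet (⋃ k, S k) := MeasurableSet.iUnion hS
          have := hasSum_single (f := fun k =>
            (if MeasurableSet (S k) ∧ (0 : ℝ) ∈ S k then (1 : H →L[ℂ] H) else 0) φ) n (by
              intro k hk
              have : (0 : ℝ) ∉ S k := fun h0 => Set.disjoint_left.1 (hd hk) h0 hn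
              simp [this])
          rw [if_pos ⟨hS', hU⟩]
          convert this using 1
          simp [hS n, hn]
        · have hU : (0 : ℝ) ∉ ⋃ k, S k := by simpa using h
          push Not at h
          simp [h] }

end ProjMeasure

/-- `B = ∫ λ dE_λ`: the domain of `B` is `{φ | ∫ λ² d(φ, E_λ φ) < ∞}`, and
`(φ, B φ) = ∫ λ d(φ, E_λ φ)` for all `φ` in it (which determines `B` by polarization). -/
structure IsSpectralMeasureOf (B : H →ₗ.[ℂ] H) (E : ProjMeasure H) : Prop where
  mem_domain_iff : ∀ φ, φ ∈ B.domain ↔ ∫⁻ x, ENNReal.ofReal (x ^ 2) ∂(E.scalar φ) < ∞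
  inner_apply : ∀ φ : B.domain, ⟪(φ : H), B φ⟫_ℂ = ((∫ x, x ∂(E.scalar (φ : H)) : ℝ) : ℂ)

open Classical in
/-- The spectral measure `E` of a self-adjoint operator `B`; the spectral projectors are
`E_λ = E((-∞, λ])`. By the spectral theorem there is exactly one `E` as in `IsSpectralMeasureOf`
for every self-adjoint `B`, so the second branch does not occur then. -/
def spectralMeasure (B : H →ₗ.[ℂ] H) : ProjMeasure H :=
  if h : ∃ E : ProjMeasure H, IsSpectralMeasureOf B E then h.choose else default

/-- The set `𝓜(B)` of all `φ` with `d(φ, E_λ φ) = |f(λ)|² dλ` for some `f ∈ L^∞(ℝ)`. -/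
def boundedDensitySet (B : H →ₗ.[ℂ] H) : Set H :=
  {φ | ∃ f : ℝ → ℂ, MemLp f ∞ volume ∧
    (spectralMeasure B).scalar φ = volume.withDensity fun x => ‖f x‖ₑ ^ 2}

/-- The absolutely continuous subspace of `B`: all `φ` for which `d(φ, E_λ φ)` is absolutely
continuous with respect to Lebesgue measure. -/
def acSubspace (B : H →ₗ.[ℂ] H) : Submodule ℂ H where
  carrier := {φ | (spectralMeasure B).scalar φ ≪ volume}
  zero_mem' := by
    simp only [mem_ofPred_eq, ProjMeasure.scalar_ac_iff]
    intro S _ _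
    exact _root_.map_zero _
  add_mem' := by
    intro φ ψ hφ hψ
    simp only [mem_ofPred_eq, ProjMeasure.scalar_ac_iff] at *
    intro S hS h0
    rw [_root_.map_add, hφ S hS h0, hψ S hS h0, add_zero]
  smul_mem' := by
    intro c φ hφ
    simp only [mem_ofPred_eq, ProjMeasure.scalar_ac_iff] at *
    intro S hS h0
    rw [map_smul, hφ S hS h0, smul_zero]

theorem isClosed_acSubspace (B : H →ₗ.[ℂ] H) : IsClosed (acSubspace B : Set H) := by
  have : (acSubspace B : Set H) = ⋂ (S : Set ℝ) (_ : MeasurableSet S) (_ : volume S = 0),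
      {φ | (spectralMeasure B).proj S φ = 0} := by
    ext φ
    simp only [mem_iInter, mem_ofPred_eq]
    exact ProjMeasure.scalar_ac_iff _ φ
  rw [this]
  refine isClosed_iInter fun S => isClosed_iInter fun _ => isClosed_iInter fun _ => ?_
  exact isClosed_eq (ContinuousLinearMap.continuous _) continuous_const

instance (B : H →ₗ.[ℂ] H) : CompleteSpace (acSubspace B) :=
  (isClosed_acSubspace B).completeSpace_coe

/-- `P_ac(B)`: the orthogonal projection onto the absolutely continuous subspace. -/
def acProj (B : H →ₗ.[ℂ] H) : H →L[ℂ] H :=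
  (acSubspace B).starProjection

end Scattering

end

/-!
Put `u t = e^{itA} J e^{-itB} φ`. In the weak sense `u' t = i e^{itA} C e^{-itB} φ`, so the task is
to turn integrability properties of `C e^{-itB} φ` into convergence of `u`.

The trace class part factors as `C₁ = G D` with Hilbert-Schmidt `G` and `D`. If `φ` has a bounded
spectral density, then Plancherel's theorem gives `∫ |(η, e^{-ivB} φ)|² dv ≤ c ‖η‖²` for all `η`,
and summing this over an orthonormal basis shows that `v ↦ S e^{-ivB} φ` is square integrable for
every Hilbert-Schmidt operator `S`, with a bound that depends only on `c` and the Hilbert-Schmidt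
norm.

Together with the integrability of `C₂ e^{-itB} φ` this gives `u (d + t) - u t → 0` for every fixed
`d`. The number `‖u x - u y‖²` is therefore minus the integral over `a > 0` of the derivative of
`‖u (x + a) - u (y + a)‖²`, whose four terms pair `e^{isA} J e^{-isB} φ` with
`e^{is'A} (G D + C₂) e^{-is'B} φ`. In the part with `G D` the unitary factors combine to
`e^{i(s - s')A}`, where `s - s'` does not depend on `a`, so that Cauchy-Schwarz applies and leaves
the tail of `∫ ‖D e^{-ivB} φ‖² dv`; hence `u` is Cauchy. Density of the vectors of bounded density
in the absolutely continuous subspace and `‖e^{itA} J e^{-itB}‖ ≤ ‖J‖` extend the convergence.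
-/

noncomputable section

namespace Scattering

section L2Calculus

/-- Bounded measurable functions, the symbols of the extended functional calculus. -/
structure BoundedMeasurable {X : Type*} [MeasurableSpace X] (f : X → ℂ) : Prop where
  measurable : Measurable f
  exists_bound : ∃ c : ℝ, ∀ x, ‖f x‖ ≤ c

/-- A functional calculus in the sense of spectral theory, before its extension to all bounded
functions: linear families of functions `eval d` on `X` and of operators `toOp d` on `H`, together
with finite measures `measure φ` for which `‖toOp d φ‖` is the norm of `eval d` in
`L²(measure φ)`. The index type `D` is the space of test functions (simple functions for a
projection-valued measure, continuous functions for a normal operator). -/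
structure L2Calculus (H X D : Type*) [NormedAddCommGroup H] [InnerProductSpace ℂ H]
    [MeasurableSpace X] [AddCommGroup D] [Module ℂ D] where
  measure : H → Measure X
  eval : D →ₗ[ℂ] X → ℂ
  toOp : D →ₗ[ℂ] H →L[ℂ] H
  isFiniteMeasure : ∀ φ, IsFiniteMeasure (measure φ)
  boundedMeasurable : ∀ d, BoundedMeasurable (eval d)
  exists_eLpNorm_sub_le : ∀ (ν : Measure X) [IsFiniteMeasure ν] (f : X → ℂ), MemLp f 2 ν →
    ∀ ε : ℝ≥0∞, ε ≠ 0 → ∃ d, eLpNorm (f - eval d) 2 ν ≤ ε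
  enorm_toOp : ∀ d φ, ‖toOp d φ‖ₑ = eLpNorm (eval d) 2 (measure φ)
  exists_one : ∃ u, eval u = 1 ∧ toOp u = 1

namespace BoundedMeasurable

variable {X : Type*} [MeasurableSpace X] {f g : X → ℂ}

theorem memLp (hf : BoundedMeasurable f) (p : ℝ≥0∞) (ν : Measure X) [IsFiniteMeasure ν] :
    MemLp f p ν := by
  obtain ⟨c, hc⟩ := hf.exists_bound
  exact MemLp.of_bound hf.measurable.aestronglyMeasurable c (ae_of_all _ hc)

theorem mul (hf : BoundedMeasurable f) (hg : BoundedMeasurable g) :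
    BoundedMeasurable (f * g) := by
  obtain ⟨c, hc⟩ := hf.exists_bound
  obtain ⟨d, hd⟩ := hg.exists_bound
  refine ⟨hf.measurable.mul hg.measurable, c * d, fun x => ?_⟩
  rw [Pi.mul_apply, norm_mul]
  exact mul_le_mul (hc x) (hd x) (norm_nonneg _) ((norm_nonneg _).trans (hc x))

theorem conj (hf : BoundedMeasurable f) :
    BoundedMeasurable (fun x => (starRingEnd ℂ) (f x)) :=
  ⟨Complex.continuous_conj.measurable.comp hf.measurable,
    hf.exists_bound.imp fun c hc x => by simpa using hc x⟩

theorem const (c : ℂ) : BoundedMeasurable (fun _ : X => c) :=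
  ⟨measurable_const, ‖c‖, fun _ => le_rfl⟩

theorem indicator_one {S : Set X} (hS : MeasurableSet S) :
    BoundedMeasurable (S.indicator (1 : X → ℂ)) :=
  ⟨measurable_one.indicator hS, 1, fun x => by by_cases hx : x ∈ S <;> simp [hx]⟩

theorem simpleFunc (s : SimpleFunc X ℂ) : BoundedMeasurable (s : X → ℂ) :=
  ⟨s.measurable, s.exists_forall_norm_le⟩

end BoundedMeasurable

theorem eq_of_forall_inner_self_eq {H : Type*} [NormedAddCommGroup H] [InnerProductSpace ℂ H]
    {S T : H →L[ℂ] H} (h : ∀ φ, ⟪φ, S φ⟫_ℂ = ⟪φ, T φ⟫_ℂ) : S = T := by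
  refine ContinuousLinearMap.coe_injective ((ext_inner_map (S : H →ₗ[ℂ] H) T).1 fun φ => ?_)
  simpa only [inner_conj_symm, ContinuousLinearMap.coe_coe] using congrArg (starRingEnd ℂ) (h φ)

theorem norm_sq_eq_integral_of_enorm_eq {X F G : Type*} [MeasurableSpace X] [NormedAddCommGroup F]
    [NormedAddCommGroup G] {ν : Measure X} {f : X → F} (hf : MemLp f 2 ν) {ψ : G}
    (h : ‖ψ‖ₑ = eLpNorm f 2 ν) : ‖ψ‖ ^ 2 = ∫ x, ‖f x‖ ^ 2 ∂ν := by
  rw [← toReal_enorm, h, hf.eLpNorm_eq_integral_rpow_norm (by norm_num) (by norm_num),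
    ENNReal.toReal_ofReal (by positivity), ← Real.rpow_natCast, ← Real.rpow_mul (by positivity)]
  norm_num

theorem eLpNorm_two_sq {X F : Type*} [MeasurableSpace X] [NormedAddCommGroup F] (f : X → F)
    (ν : Measure X) : eLpNorm f 2 ν ^ 2 = ∫⁻ x, ‖f x‖ₑ ^ 2 ∂ν := by
  simpa using eLpNorm_nnreal_pow_eq_lintegral (f := f) (μ := ν) (p := 2) two_ne_zero

theorem enorm_eq_eLpNorm_two {X F G : Type*} [MeasurableSpace X] [NormedAddCommGroup F]
    [NormedAddCommGroup G] {ν : Measure X} {f : X → F} {ψ : G}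
    (h : ‖ψ‖ₑ ^ 2 = ∫⁻ x, ‖f x‖ₑ ^ 2 ∂ν) : ‖ψ‖ₑ = eLpNorm f 2 ν :=
  (ENNReal.pow_right_strictMono two_ne_zero).injective (h.trans (eLpNorm_two_sq f ν).symm)

theorem memLp_two_iff_lintegral_ofReal_sq_lt_top {X F : Type*} [MeasurableSpace X]
    [NormedAddCommGroup F] {ν : Measure X} {f : X → F} {l : X → ℝ} (hf : AEStronglyMeasurable f ν)
    (hl : ∀ x, ‖f x‖ = |l x|) : MemLp f 2 ν ↔ ∫⁻ x, ENNReal.ofReal (l x ^ 2) ∂ν < ∞ := by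
  have henorm : ∀ x, ENNReal.ofReal (l x ^ 2) = ‖f x‖ₑ ^ 2 := fun x => by
    rw [← ofReal_norm, ← ENNReal.ofReal_pow (norm_nonneg _), hl, sq_abs]
  simp only [henorm]
  rw [MemLp, and_iff_right hf, ← eLpNorm_two_sq, ENNReal.pow_lt_top_iff, or_iff_left two_ne_zero]

theorem memLp_two_add_measure {X F : Type*} [MeasurableSpace X] [NormedAddCommGroup F] {f : X → F}
    {ν ρ : Measure X} (hν : MemLp f 2 ν) (hρ : MemLp f 2 ρ) : MemLp f 2 (ν + ρ) := by
  rw [memLp_two_iff_integrable_sq_norm (hν.1.add_measure hρ.1)]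
  exact ((memLp_two_iff_integrable_sq_norm hν.1).1 hν).add_measure
    ((memLp_two_iff_integrable_sq_norm hρ.1).1 hρ)

namespace L2Calculus

variable {H X D : Type*} [NormedAddCommGroup H] [InnerProductSpace ℂ H] [MeasurableSpace X]
  [AddCommGroup D] [Module ℂ D] (F : L2Calculus H X D)

instance (φ : H) : IsFiniteMeasure (F.measure φ) := F.isFiniteMeasure φ

theorem memLp (ν : Measure X) [IsFiniteMeasure ν] (d : D) : MemLp (F.eval d) 2 ν :=
  (F.boundedMeasurable d).memLp 2 ν

/-- The test functions as elements of `L²(ν)`. -/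
def toLp (ν : Measure X) [IsFiniteMeasure ν] : D →ₗ[ℂ] Lp ℂ 2 ν where
  toFun d := (F.memLp ν d).toLp
  map_add' d e := by simp only [map_add]; exact MemLp.toLp_add _ _
  map_smul' c d := by simp only [map_smul]; exact MemLp.toLp_const_smul _ _

theorem edist_toLp {ν : Measure X} [IsFiniteMeasure ν] {f : X → ℂ} (hf : MemLp f 2 ν) (d : D) :
    edist hf.toLp (F.toLp ν d) = eLpNorm (f - F.eval d) 2 ν :=
  Lp.edist_toLp_toLp _ _ hf (F.memLp ν d)

theorem denseRange_toLp (ν : Measure X) [IsFiniteMeasure ν] : DenseRange (F.toLp ν) := by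
  refine fun f => EMetric.mem_closure_iff.2 fun ε hε => ?_
  obtain ⟨δ, hδ, hδε⟩ := exists_between hε
  obtain ⟨d, hd⟩ := F.exists_eLpNorm_sub_le ν f (Lp.memLp f) δ hδ.ne'
  refine ⟨F.toLp ν d, mem_range_self d, lt_of_le_of_lt ?_ hδε⟩
  rwa [← F.edist_toLp (Lp.memLp f), Lp.toLp_coeFn] at hd

theorem exists_tendsto_eLpNorm_sub (ν : Measure X) [IsFiniteMeasure ν] {f : X → ℂ}
    (hf : MemLp f 2 ν) :
    ∃ d : ℕ → D, Tendsto (fun n => eLpNorm (f - F.eval (d n)) 2 ν) atTop (𝓝 0) := by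
  choose d hd using fun n : ℕ => F.exists_eLpNorm_sub_le ν f hf ((n : ℝ≥0∞)⁻¹) (by simp)
  exact ⟨d, tendsto_of_tendsto_of_tendsto_of_le_of_le tendsto_const_nhds
    ENNReal.tendsto_inv_nat_nhds_zero (fun _ => zero_le) hd⟩

/-- The test vectors `toOp d φ` as a linear function of `d`. -/
def testVector (φ : H) : D →ₗ[ℂ] H :=
  (ContinuousLinearMap.apply ℂ H φ).toLinearMap ∘ₗ F.toOp

theorem norm_testVector (φ : H) (d : D) :
    ‖F.testVector φ d‖ = ‖F.toLp (F.measure φ) d‖ := by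
  refine (enorm_eq_iff_norm_eq).1 ((F.enorm_toOp d φ).trans ?_)
  exact (Lp.enorm_toLp (hf := F.memLp (F.measure φ) d)).symm

variable [CompleteSpace H]

/-- The isometry of `L²(measure φ)` into `H` that maps a test function `d` to `toOp d φ`: its
value at `f` is the vector `f φ` of the extended calculus. -/
def vector (φ : H) : Lp ℂ 2 (F.measure φ) →ₗᵢ[ℂ] H where
  toLinearMap := ((F.testVector φ).extendOfNorm (F.toLp (F.measure φ))).toLinearMap
  norm_map' := fun f => by
    refine (F.denseRange_toLp (F.measure φ)).induction_on f
      (isClosed_eq (by fun_prop) continuous_norm) fun d => ?_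
    rw [ContinuousLinearMap.coe_coe, LinearMap.extendOfNorm_eq (F.denseRange_toLp _)
      ⟨1, fun d => by rw [one_mul, F.norm_testVector]⟩, F.norm_testVector]

theorem vector_toLp (φ : H) (d : D) : F.vector φ (F.toLp _ d) = F.toOp d φ :=
  LinearMap.extendOfNorm_eq (F.denseRange_toLp _)
    ⟨1, fun d => by rw [one_mul, F.norm_testVector]⟩ d

/-- `ψ` is the vector `f φ` of the extended calculus; this requires `f ∈ L²(measure φ)`. -/
def Represents (φ : H) (f : X → ℂ) (ψ : H) : Prop :=
  ∃ hf : MemLp f 2 (F.measure φ), F.vector φ hf.toLp = ψ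

theorem represents_vector (φ : H) {f : X → ℂ} (hf : MemLp f 2 (F.measure φ)) :
    F.Represents φ f (F.vector φ hf.toLp) :=
  ⟨hf, rfl⟩

theorem represents_eval (d : D) (φ : H) : F.Represents φ (F.eval d) (F.toOp d φ) :=
  ⟨F.memLp _ d, F.vector_toLp φ d⟩

theorem represents_one (φ : H) : F.Represents φ 1 φ := by
  obtain ⟨u, hu, hu'⟩ := F.exists_one
  simpa [hu, hu'] using F.represents_eval u φ

namespace Represents

variable {F} {φ φ' ψ ψ' : H} {f g : X → ℂ}

theorem memLp (h : F.Represents φ f ψ) : MemLp f 2 (F.measure φ) := h.1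

theorem unique (h : F.Represents φ f ψ) (h' : F.Represents φ f ψ') : ψ = ψ' := by
  obtain ⟨-, rfl⟩ := h
  obtain ⟨-, rfl⟩ := h'
  rfl

theorem congr_ae (h : F.Represents φ f ψ) (hfg : f =ᵐ[F.measure φ] g) :
    F.Represents φ g ψ := by
  obtain ⟨hf, rfl⟩ := h
  exact ⟨hf.ae_eq hfg, congrArg _ (MemLp.toLp_congr _ _ hfg.symm)⟩

theorem add (h : F.Represents φ f ψ) (h' : F.Represents φ g ψ') :
    F.Represents φ (f + g) (ψ + ψ') := by
  obtain ⟨hf, rfl⟩ := h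
  obtain ⟨hg, rfl⟩ := h'
  exact ⟨hf.add hg, by rw [MemLp.toLp_add hf hg, map_add]⟩

theorem smul (c : ℂ) (h : F.Represents φ f ψ) : F.Represents φ (c • f) (c • ψ) := by
  obtain ⟨hf, rfl⟩ := h
  exact ⟨hf.const_smul c, by rw [MemLp.toLp_const_smul c hf, map_smul]⟩

theorem sub (h : F.Represents φ f ψ) (h' : F.Represents φ g ψ') :
    F.Represents φ (f - g) (ψ - ψ') := by
  obtain ⟨hf, rfl⟩ := h
  obtain ⟨hg, rfl⟩ := h'
  exact ⟨hf.sub hg, by rw [MemLp.toLp_sub hf hg, map_sub]⟩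

theorem enorm_eq (h : F.Represents φ f ψ) : ‖ψ‖ₑ = eLpNorm f 2 (F.measure φ) := by
  obtain ⟨hf, rfl⟩ := h
  rw [LinearIsometry.enorm_map, Lp.enorm_toLp]

theorem norm_sq_eq (h : F.Represents φ f ψ) : ‖ψ‖ ^ 2 = ∫ x, ‖f x‖ ^ 2 ∂F.measure φ :=
  norm_sq_eq_integral_of_enorm_eq h.memLp h.enorm_eq

theorem inner_eq (h : F.Represents φ f ψ) (h' : F.Represents φ g ψ') :
    ⟪ψ, ψ'⟫_ℂ = ∫ x, (starRingEnd ℂ) (f x) * g x ∂F.measure φ := by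
  obtain ⟨hf, rfl⟩ := h
  obtain ⟨hg, rfl⟩ := h'
  rw [LinearIsometry.inner_map_map, L2.inner_def]
  refine integral_congr_ae ?_
  filter_upwards [hf.coeFn_toLp, hg.coeFn_toLp] with x hx hx'
  rw [hx, hx', RCLike.inner_apply']

theorem inner_left_eq (h : F.Represents φ f ψ) : ⟪φ, ψ⟫_ℂ = ∫ x, f x ∂F.measure φ := by
  simpa using (F.represents_one φ).inner_eq h

theorem tendsto_toOp (h : F.Represents φ f ψ) {d : ℕ → D}
    (hd : Tendsto (fun n => eLpNorm (f - F.eval (d n)) 2 (F.measure φ)) atTop (𝓝 0)) :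
    Tendsto (fun n => F.toOp (d n) φ) atTop (𝓝 ψ) := by
  obtain ⟨hf, rfl⟩ := h
  simp only [← F.vector_toLp]
  refine ((F.vector φ).continuous.tendsto _).comp (tendsto_iff_edist_tendsto_0.2 ?_)
  simpa only [edist_comm _ hf.toLp, F.edist_toLp] using hd

theorem tendsto_of_dominated {ι : Type*} {l : Filter ι} [l.IsCountablyGenerated]
    {f : ι → X → ℂ} {ψ : ι → H} {ψ₀ : H} {b : X → ℝ} (hf : ∀ i, F.Represents φ (f i) (ψ i))
    (hg : F.Represents φ g ψ₀) (hb : MemLp b 2 (F.measure φ))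
    (hbound : ∀ i x, ‖f i x - g x‖ ≤ b x)
    (hlim : ∀ x, Tendsto (fun i => f i x) l (𝓝 (g x))) : Tendsto ψ l (𝓝 ψ₀) := by
  have hsq : Tendsto (fun i => ‖ψ i - ψ₀‖ ^ 2) l (𝓝 (∫ _, (0 : ℝ) ∂F.measure φ)) := by
    simp only [fun i => ((hf i).sub hg).norm_sq_eq]
    refine tendsto_integral_filter_of_dominated_convergence (fun x => b x ^ 2) ?_ ?_
      hb.integrable_sq (ae_of_all _ fun x => ?_)
    · exact Eventually.of_forall fun i => ((hf i).sub hg).memLp.1.norm.pow 2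
    · refine Eventually.of_forall fun i => ae_of_all _ fun x => ?_
      rw [Real.norm_of_nonneg (by positivity)]
      exact pow_le_pow_left₀ (norm_nonneg _) (hbound i x) 2
    · simpa using ((hlim x).sub_const (g x)).norm.pow 2
  rw [integral_zero] at hsq
  exact tendsto_iff_norm_sub_tendsto_zero.2 (by simpa using hsq.sqrt)

theorem memLp_of_tendsto {f : ℕ → X → ℂ} {ψ : ℕ → H} {ψ₀ : H}
    (hf : ∀ n, F.Represents φ (f n) (ψ n))
    (hlim : ∀ x, Tendsto (fun n => f n x) atTop (𝓝 (g x))) (hψ : Tendsto ψ atTop (𝓝 ψ₀)) :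
    MemLp g 2 (F.measure φ) := by
  refine ⟨aestronglyMeasurable_of_tendsto_ae atTop (fun n => (hf n).memLp.1) (ae_of_all _ hlim),
    (Lp.eLpNorm_lim_le_liminf_eLpNorm (fun n => (hf n).memLp.1) g (ae_of_all _ hlim)).trans_lt ?_⟩
  simp only [← fun n => (hf n).enorm_eq]
  rw [hψ.enorm.liminf_eq]
  finiteness

theorem smul_vector_add (c : ℂ) (h : F.Represents φ f ψ) (h' : F.Represents φ' f ψ')
    (hf : MemLp f 2 (F.measure (c • φ + φ'))) :
    F.Represents (c • φ + φ') f (c • ψ + ψ') := by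
  obtain ⟨d, hd⟩ := F.exists_tendsto_eLpNorm_sub
    (F.measure φ + F.measure φ' + F.measure (c • φ + φ'))
    (memLp_two_add_measure (memLp_two_add_measure h.memLp h'.memLp) hf)
  have tendsto_of_le : ∀ ν ≤ F.measure φ + F.measure φ' + F.measure (c • φ + φ'),
      Tendsto (fun n => eLpNorm (f - F.eval (d n)) 2 ν) atTop (𝓝 0) := fun ν hν =>
    tendsto_of_tendsto_of_tendsto_of_le_of_le tendsto_const_nhds hd (fun _ => zero_le)
      fun n => eLpNorm_mono_measure _ hν
  have hsum := (F.represents_vector _ hf).tendsto_toOp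
    (tendsto_of_le _ (Measure.le_add_left le_rfl))
  simp only [map_add, map_smul] at hsum
  have heq := tendsto_nhds_unique hsum
    (((h.tendsto_toOp (tendsto_of_le _
      (Measure.le_add_right (Measure.le_add_right le_rfl)))).const_smul c).add
    (h'.tendsto_toOp (tendsto_of_le _ (Measure.le_add_right (Measure.le_add_left le_rfl)))))
  exact ⟨hf, heq⟩

end Represents

theorem norm_sq_eq_measureReal (φ : H) : ‖φ‖ ^ 2 = (F.measure φ).real univ := by
  simpa using (F.represents_one φ).norm_sq_eq

theorem sq_integral_le_of_bound {f : X → ℂ} {c : ℝ} (hc : ∀ x, ‖f x‖ ≤ c) (φ : H) :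
    ∫ x, ‖f x‖ ^ 2 ∂F.measure φ ≤ (|c| * ‖φ‖) ^ 2 := by
  calc ∫ x, ‖f x‖ ^ 2 ∂F.measure φ
      ≤ ∫ _, c ^ 2 ∂F.measure φ :=
        integral_mono_of_nonneg (ae_of_all _ fun x => by positivity) (integrable_const _)
          (ae_of_all _ fun x => pow_le_pow_left₀ (norm_nonneg _) (hc x) 2)
    _ = (|c| * ‖φ‖) ^ 2 := by
        rw [integral_const, mul_pow, sq_abs, F.norm_sq_eq_measureReal, smul_eq_mul, mul_comm]

theorem exists_op {f : X → ℂ} (hf : BoundedMeasurable f) :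
    ∃ T : H →L[ℂ] H, ∀ φ, F.Represents φ f (T φ) := by
  have hT : ∀ φ, F.Represents φ f (F.vector φ (hf.memLp 2 (F.measure φ)).toLp) :=
    fun φ => F.represents_vector φ _
  obtain ⟨c, hc⟩ := hf.exists_bound
  let T : H →ₗ[ℂ] H := IsLinearMap.mk' (fun φ => F.vector φ (hf.memLp 2 (F.measure φ)).toLp) <|
    { map_add := fun φ ψ => by
        have := (hT φ).smul_vector_add 1 (hT ψ) (hf.memLp 2 _)
        rw [one_smul, one_smul] at this
        exact (hT (φ + ψ)).unique this
      map_smul := fun a φ => by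
        have h0 : F.vector 0 (hf.memLp 2 (F.measure 0)).toLp = 0 := by
          have := (hT 0).norm_sq_eq.trans_le (F.sq_integral_le_of_bound hc 0)
          rw [norm_zero, mul_zero, zero_pow two_ne_zero] at this
          exact norm_eq_zero.1 ((sq_nonpos_iff _).1 this)
        have := (hT φ).smul_vector_add a (hT 0) (hf.memLp 2 _)
        rw [h0, add_zero, add_zero] at this
        exact (hT (a • φ)).unique this }
  refine ⟨T.mkContinuous |c| fun φ => ?_, hT⟩
  exact abs_le_of_sq_le_sq' ((hT φ).norm_sq_eq.trans_le (F.sq_integral_le_of_bound hc φ))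
    (mul_nonneg (abs_nonneg c) (norm_nonneg φ)) |>.2

open Classical in
/-- The operator of a bounded measurable function in the extended calculus. -/
def op (f : X → ℂ) : H →L[ℂ] H :=
  if h : ∃ T : H →L[ℂ] H, ∀ φ, F.Represents φ f (T φ) then h.choose else 0

variable {f g : X → ℂ}

theorem represents_op (hf : BoundedMeasurable f) (φ : H) : F.Represents φ f (F.op f φ) := by
  rw [op, dif_pos (F.exists_op hf)]
  exact (F.exists_op hf).choose_spec φ

theorem op_eq_of_represents (hf : BoundedMeasurable f) {T : H →L[ℂ] H}
    (hT : ∀ φ, F.Represents φ f (T φ)) : F.op f = T :=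
  ContinuousLinearMap.ext fun φ => (F.represents_op hf φ).unique (hT φ)

theorem op_one : F.op 1 = 1 :=
  F.op_eq_of_represents (.const 1) F.represents_one

theorem op_eval (d : D) : F.op (F.eval d) = F.toOp d :=
  F.op_eq_of_represents (F.boundedMeasurable d) (F.represents_eval d)

theorem inner_op (hf : BoundedMeasurable f) (φ : H) :
    ⟪φ, F.op f φ⟫_ℂ = ∫ x, f x ∂F.measure φ :=
  (F.represents_op hf φ).inner_left_eq

theorem op_eq_of_inner (hf : BoundedMeasurable f) {T : H →L[ℂ] H}
    (hT : ∀ φ, ⟪φ, T φ⟫_ℂ = ∫ x, f x ∂F.measure φ) : F.op f = T :=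
  eq_of_forall_inner_self_eq fun φ => by rw [F.inner_op hf, hT]

theorem op_conj (hf : BoundedMeasurable f) :
    F.op (fun x => (starRingEnd ℂ) (f x)) = ContinuousLinearMap.adjoint (F.op f) := by
  refine F.op_eq_of_inner hf.conj fun φ => ?_
  rw [ContinuousLinearMap.adjoint_inner_right, integral_conj, ← F.inner_op hf, inner_conj_symm]

theorem op_mul (hf : BoundedMeasurable f) (hg : BoundedMeasurable g) :
    F.op (f * g) = F.op f * F.op g := by
  refine F.op_eq_of_inner (hf.mul hg) fun φ => ?_
  rw [mul_apply_eq_comp, ← ContinuousLinearMap.adjoint_inner_left, ← F.op_conj hf,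
    (F.represents_op hf.conj φ).inner_eq (F.represents_op hg φ)]
  simp only [Complex.conj_conj, Pi.mul_apply]

variable {F} in
theorem Represents.op {φ ψ : H} (h : F.Represents φ f ψ) (hg : BoundedMeasurable g) :
    F.Represents φ (g * f) (F.op g ψ) := by
  obtain ⟨c, hc⟩ := hg.exists_bound
  have hgf : MemLp (g * f) 2 (F.measure φ) :=
    MemLp.of_le_mul (c := c) h.memLp (hg.measurable.aestronglyMeasurable.mul h.memLp.1)
      (ae_of_all _ fun x => (norm_mul _ _).trans_le
        (mul_le_mul_of_nonneg_right (hc x) (norm_nonneg _)))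
  obtain ⟨d, hd⟩ := F.exists_tendsto_eLpNorm_sub (F.measure φ) h.memLp
  have htest : ∀ n, F.Represents φ (g * F.eval (d n)) (F.op g (F.toOp (d n) φ)) := fun n => by
    rw [← F.op_eval, ← mul_apply_eq_comp, ← F.op_mul hg (F.boundedMeasurable _)]
    exact F.represents_op (hg.mul (F.boundedMeasurable _)) φ
  have hlim : Tendsto (fun n => F.op g (F.toOp (d n) φ)) atTop (𝓝 (F.vector φ hgf.toLp)) := by
    refine tendsto_iff_edist_tendsto_0.2 (tendsto_of_tendsto_of_tendsto_of_le_of_le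
      (h := fun n => ENNReal.ofReal c * eLpNorm (f - F.eval (d n)) 2 (F.measure φ))
      tendsto_const_nhds (by simpa using ENNReal.Tendsto.const_mul hd (Or.inr (by finiteness)))
      (fun _ => zero_le) fun n => ?_)
    rw [edist_comm, edist_eq_enorm_sub, ((F.represents_vector φ hgf).sub (htest n)).enorm_eq,
      ← mul_sub]
    exact eLpNorm_le_mul_eLpNorm_of_ae_le_mul (ae_of_all _ fun x => (norm_mul _ _).trans_le
      (mul_le_mul_of_nonneg_right (hc x) (norm_nonneg _))) 2
  exact ⟨hgf, tendsto_nhds_unique hlim (((F.op g).continuous.tendsto ψ).comp (h.tendsto_toOp hd))⟩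

theorem enorm_op_sq (hf : BoundedMeasurable f) (φ : H) :
    ‖F.op f φ‖ₑ ^ 2 = ∫⁻ x, ‖f x‖ₑ ^ 2 ∂F.measure φ := by
  rw [(F.represents_op hf φ).enorm_eq, eLpNorm_two_sq]

theorem enorm_op_indicator_mul_sq (hf : BoundedMeasurable f) {S : Set X} (hS : MeasurableSet S)
    (φ : H) : ‖F.op (S.indicator 1 * f) φ‖ₑ ^ 2 = ∫⁻ x in S, ‖f x‖ₑ ^ 2 ∂F.measure φ := by
  rw [F.enorm_op_sq ((BoundedMeasurable.indicator_one hS).mul hf), ← lintegral_indicator hS]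
  refine lintegral_congr fun x => ?_
  by_cases hx : x ∈ S <;> simp [hx]

theorem enorm_op_indicator_sq {S : Set X} (hS : MeasurableSet S) (φ : H) :
    ‖F.op (S.indicator 1) φ‖ₑ ^ 2 = F.measure φ S := by
  have := F.enorm_op_indicator_mul_sq (.const 1) hS φ
  rw [show (fun _ : X => (1 : ℂ)) = 1 from rfl, mul_one] at this
  simpa using this

theorem measure_op (hf : BoundedMeasurable f) (φ : H) :
    F.measure (F.op f φ) = (F.measure φ).withDensity fun x => ‖f x‖ₑ ^ 2 := by
  ext S hS
  rw [withDensity_apply _ hS, ← F.enorm_op_indicator_mul_sq hf hS,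
    F.op_mul (.indicator_one hS) hf, ← F.enorm_op_indicator_sq hS, mul_apply_eq_comp]

theorem isStarProjection_op_indicator {S : Set X} (hS : MeasurableSet S) :
    IsStarProjection (F.op (S.indicator 1)) := by
  have hb := BoundedMeasurable.indicator_one hS
  refine ⟨?_, ?_⟩
  · rw [IsIdempotentElem, ← F.op_mul hb hb, ← inter_indicator_one, inter_self]
  · rw [IsSelfAdjoint, ContinuousLinearMap.star_eq_adjoint, ← F.op_conj hb]
    congr 1
    ext x
    by_cases hx : x ∈ S <;> simp [hx]

theorem op_indicator_union {S T : Set X} (hS : MeasurableSet S) (hT : MeasurableSet T)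
    (hd : Disjoint S T) :
    F.op ((S ∪ T).indicator 1) = F.op (S.indicator 1) + F.op (T.indicator 1) := by
  refine F.op_eq_of_represents (.indicator_one (hS.union hT)) fun φ => ?_
  rw [indicator_union_of_disjoint hd]
  exact (F.represents_op (.indicator_one hS) φ).add (F.represents_op (.indicator_one hT) φ)

theorem op_zero : F.op 0 = 0 :=
  F.op_eq_of_represents (.const 0) fun φ => by
    have := (F.represents_one φ).smul 0
    rwa [zero_smul, zero_smul] at this

theorem op_indicator_biUnion {ι : Type*} {S : ι → Set X} (hS : ∀ i, MeasurableSet (S i))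
    (hd : Pairwise (Function.onFun Disjoint S)) (s : Finset ι) :
    F.op ((⋃ i ∈ s, S i).indicator 1) = ∑ i ∈ s, F.op ((S i).indicator 1) := by
  classical
  induction s using Finset.induction_on with
  | empty =>
    simp only [Finset.notMem_empty, iUnion_false, iUnion_empty, indicator_empty,
      Finset.sum_empty]
    exact F.op_zero
  | insert i s hi ih =>
    rw [Finset.set_biUnion_insert, Finset.sum_insert hi, ← ih]
    refine F.op_indicator_union (hS i) (s.measurableSet_biUnion fun j _ => hS j)
      (disjoint_iUnion₂_right.2 fun j hj => hd ?_)
    rintro rfl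
    exact hi hj

theorem tendsto_op_indicator {ι : Type*} {l : Filter ι} {S : ι → Set X} {T : Set X}
    (hS : ∀ i, MeasurableSet (S i)) (hT : MeasurableSet T) (φ : H)
    (h : Tendsto (fun i => F.measure φ (symmDiff (S i) T)) l (𝓝 0)) :
    Tendsto (fun i => F.op ((S i).indicator 1) φ) l (𝓝 (F.op (T.indicator 1) φ)) := by
  have hvector : ∀ {A : Set X} (hA : MeasurableSet A),
      F.vector φ (indicatorConstLp 2 hA (measure_ne_top _ _) 1) = F.op (A.indicator 1) φ :=
    fun hA => (F.represents_op (.indicator_one hA) φ).2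
  simp only [← hvector (hS _), ← hvector hT]
  exact ((F.vector φ).continuous.tendsto _).comp (tendsto_indicatorConstLp_set (by simp) h)

theorem hasSum_op_indicator {S : ℕ → Set X} (hS : ∀ n, MeasurableSet (S n))
    (hd : Pairwise (Function.onFun Disjoint S)) (φ : H) :
    HasSum (fun n => F.op ((S n).indicator 1) φ) (F.op ((⋃ n, S n).indicator 1) φ) := by
  have hpartial : ∀ s : Finset ℕ, MeasurableSet (⋃ n ∈ s, S n) :=
    fun s => s.measurableSet_biUnion fun n _ => hS n
  have hempty : ⋂ s : Finset ℕ, (⋃ n, S n) \ ⋃ n ∈ s, S n = ∅ := by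
    refine eq_empty_of_forall_notMem fun x hx => ?_
    obtain ⟨n, hn⟩ := mem_iUnion.1 (mem_iInter.1 hx ∅).1
    exact (mem_iInter.1 hx {n}).2 (by simpa using hn)
  have hmeasure := tendsto_measure_iInter_atTop (μ := F.measure φ)
    (fun s => ((MeasurableSet.iUnion hS).diff (hpartial s)).nullMeasurableSet)
    (fun s t hst => sdiff_subset_sdiff_right (biUnion_subset_biUnion_left hst))
    ⟨∅, measure_ne_top _ _⟩
  rw [hempty, measure_empty] at hmeasure
  refine (F.tendsto_op_indicator hpartial (MeasurableSet.iUnion hS) φ ?_).congr fun s => ?_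
  · refine hmeasure.congr fun s => ?_
    rw [symmDiff_of_le (iUnion₂_subset fun n _ => subset_iUnion S n), Function.comp_apply]
  · rw [F.op_indicator_biUnion hS hd, sum_apply]

end L2Calculus

end L2Calculus

section ProjectionValuedMeasure

variable {H : Type*} [NormedAddCommGroup H] [InnerProductSpace ℂ H]

theorem norm_sum_sq_of_pairwise_inner_eq_zero {ι : Type*} {s : Finset ι} {v : ι → H}
    (hv : ∀ i ∈ s, ∀ j ∈ s, i ≠ j → ⟪v i, v j⟫_ℂ = 0) :
    ‖∑ i ∈ s, v i‖ ^ 2 = ∑ i ∈ s, ‖v i‖ ^ 2 := by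
  suffices h : ((‖∑ i ∈ s, v i‖ : ℂ)) ^ 2 = ∑ i ∈ s, (‖v i‖ : ℂ) ^ 2 by exact_mod_cast h
  rw [← Complex.coe_algebraMap, ← inner_self_eq_norm_sq_to_K, sum_inner]
  refine Finset.sum_congr rfl fun i hi => ?_
  rw [inner_sum, Finset.sum_eq_single_of_mem i hi fun j hj hji => hv i hi j hj hji.symm,
    inner_self_eq_norm_sq_to_K]

namespace ProjMeasure

variable [CompleteSpace H] (E : ProjMeasure H)

/-- The `H`-valued measure `S ↦ E(S) φ`. -/
def vectorMeasure (φ : H) : VectorMeasure ℝ H where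
  measureOf' S := E.proj S φ
  empty' := by rw [E.empty, zero_apply]
  not_measurable' S hS := by rw [E.not_measurable S hS, zero_apply]
  m_iUnion' S hS hd := E.hasSum_iUnion S hS hd φ

theorem proj_union {S T : Set ℝ} (hS : MeasurableSet S) (hT : MeasurableSet T)
    (hd : Disjoint S T) : E.proj (S ∪ T) = E.proj S + E.proj T :=
  ContinuousLinearMap.ext fun φ => (E.vectorMeasure φ).of_union hd hS hT

theorem inner_proj_proj {S : Set ℝ} (hS : MeasurableSet S) (φ ψ : H) :
    ⟪E.proj S φ, ψ⟫_ℂ = ⟪φ, E.proj S ψ⟫_ℂ := by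
  conv_rhs => rw [← (E.isStarProjection S hS).isSelfAdjoint.star_eq,
    ContinuousLinearMap.star_eq_adjoint, ContinuousLinearMap.adjoint_inner_right]

theorem inner_proj_of_disjoint {S T : Set ℝ} (hS : MeasurableSet S) (hT : MeasurableSet T)
    (hd : Disjoint S T) (φ : H) : ⟪E.proj S φ, E.proj T φ⟫_ℂ = 0 := by
  have hPS := (E.isStarProjection S hS).isIdempotentElem
  have hPT := (E.isStarProjection T hT).isIdempotentElem
  have hsum := (E.isStarProjection _ (hS.union hT)).isIdempotentElem
  rw [E.proj_union hS hT hd, hPS.add_iff hPT] at hsum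
  have := IsAddTorsionFree.of_isTorsionFree ℂ (H →L[ℂ] H)
  rw [E.inner_proj_proj hS, ← mul_apply_eq_comp, hPS.mul_eq_zero_of_anticommute hsum,
    zero_apply, inner_zero_right]

theorem scalar_apply_eq_enorm_sq (φ : H) {S : Set ℝ} (hS : MeasurableSet S) :
    E.scalar φ S = ‖E.proj S φ‖ₑ ^ 2 := by
  rw [E.scalar_apply φ hS, E.inner_proj hS, ENNReal.ofReal_pow (norm_nonneg _), ofReal_norm]

instance (φ : H) : IsFiniteMeasure (E.scalar φ) :=
  ⟨by rw [E.scalar_apply_eq_enorm_sq φ MeasurableSet.univ]; finiteness⟩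

/-- The operator `∑ c, c • E(s⁻¹{c})` of a simple function `s`. -/
def simpleOp : SimpleFunc ℝ ℂ →ₗ[ℂ] H →L[ℂ] H :=
  let T : Set ℝ → ℂ →L[ℝ] (H →L[ℂ] H) := fun S =>
    (ContinuousLinearMap.toSpanSingleton ℂ (E.proj S)).restrictScalars ℝ
  have hT : FinMeasAdditive (0 : Measure ℝ) T := fun S S' hS hS' _ _ hd => by
    ext c : 1
    simp [T, E.proj_union hS hS' hd]
  { toFun := SimpleFunc.setToSimpleFunc T
    map_add' := fun f g => SimpleFunc.setToSimpleFunc_add T hT (μ := 0) (by simp) (by simp)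
    map_smul' := fun c f => SimpleFunc.setToSimpleFunc_smul T hT
      (fun c s x => by simp [T, mul_smul]) c (by simp) }

theorem simpleOp_apply (s : SimpleFunc ℝ ℂ) (φ : H) :
    E.simpleOp s φ = ∑ c ∈ s.range, c • E.proj (s ⁻¹' {c}) φ := by
  change (∑ c ∈ s.range, c • E.proj (s ⁻¹' {c})) φ = _
  simp

theorem norm_simpleOp_sq (s : SimpleFunc ℝ ℂ) (φ : H) :
    ‖E.simpleOp s φ‖ ^ 2 = ∑ c ∈ s.range, ‖c‖ ^ 2 * ‖E.proj (s ⁻¹' {c}) φ‖ ^ 2 := by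
  simp only [simpleOp_apply, ← mul_pow, ← norm_smul]
  refine norm_sum_sq_of_pairwise_inner_eq_zero fun c _ d _ hcd => ?_
  rw [inner_smul_left, inner_smul_right, E.inner_proj_of_disjoint (s.measurableSet_preimage _)
    (s.measurableSet_preimage _) (Disjoint.preimage _ (by simpa using hcd)), mul_zero, mul_zero]

theorem enorm_simpleOp_sq (s : SimpleFunc ℝ ℂ) (φ : H) :
    ‖E.simpleOp s φ‖ₑ ^ 2 = ∫⁻ x, ‖s x‖ₑ ^ 2 ∂E.scalar φ := by
  calc ‖E.simpleOp s φ‖ₑ ^ 2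
      = ∑ c ∈ s.range, ‖c‖ₑ ^ 2 * E.scalar φ (s ⁻¹' {c}) := by
        rw [← ofReal_norm, ← ENNReal.ofReal_pow (norm_nonneg _), norm_simpleOp_sq,
          ENNReal.ofReal_sum_of_nonneg fun c _ => by positivity]
        refine Finset.sum_congr rfl fun c _ => ?_
        rw [E.scalar_apply_eq_enorm_sq φ (s.measurableSet_preimage _),
          ENNReal.ofReal_mul (by positivity), ENNReal.ofReal_pow (norm_nonneg _),
          ENNReal.ofReal_pow (norm_nonneg _), ofReal_norm, ofReal_norm]
    _ = ∫⁻ x, (s.map fun c => ‖c‖ₑ ^ 2) x ∂E.scalar φ := by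
        rw [SimpleFunc.lintegral_eq_lintegral, SimpleFunc.map_lintegral]
    _ = ∫⁻ x, ‖s x‖ₑ ^ 2 ∂E.scalar φ := rfl

/-- The functional calculus of a projection-valued measure on simple functions. -/
def calculus : L2Calculus H ℝ (SimpleFunc ℝ ℂ) where
  measure := E.scalar
  eval := { toFun := fun s => s, map_add' := fun _ _ => rfl, map_smul' := fun _ _ => rfl }
  toOp := E.simpleOp
  isFiniteMeasure φ := inferInstance
  boundedMeasurable s := .simpleFunc s
  exists_eLpNorm_sub_le ν _ f hf ε hε := by
    obtain ⟨g, hg, -⟩ := hf.exists_simpleFunc_eLpNorm_sub_lt (by norm_num) hε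
    exact ⟨g, hg.le⟩
  enorm_toOp s φ := enorm_eq_eLpNorm_two (E.enorm_simpleOp_sq s φ)
  exists_one := ⟨SimpleFunc.const ℝ 1, rfl, by
    ext φ
    have : (1 : ℝ → ℂ) ⁻¹' {1} = Set.univ := by ext; simp
    rw [simpleOp_apply]
    simp [this, E.univ]⟩

theorem calculus_op_indicator {S : Set ℝ} (hS : MeasurableSet S) :
    E.calculus.op (S.indicator 1) = E.proj S := by
  refine E.calculus.op_eq_of_inner (.indicator_one hS) fun φ => ?_
  have hidem : E.proj S φ = E.proj S (E.proj S φ) :=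
    congrArg (fun T : H →L[ℂ] H => T φ) (E.isStarProjection S hS).isIdempotentElem.eq.symm
  rw [hidem, ← E.inner_proj_proj hS, inner_self_eq_norm_sq_to_K,
    MeasureTheory.integral_indicator hS]
  simp [calculus, Measure.real, E.scalar_apply_eq_enorm_sq φ hS]

theorem scalar_op {f : ℝ → ℂ} (hf : BoundedMeasurable f) (φ : H) :
    E.scalar (E.calculus.op f φ) = (E.scalar φ).withDensity fun x => ‖f x‖ₑ ^ 2 :=
  E.calculus.measure_op hf φ

end ProjMeasure

end ProjectionValuedMeasure

section UnitaryGroup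

variable {H : Type*} [NormedAddCommGroup H] [InnerProductSpace ℂ H]

theorem inner_map_eq_zero_of_inner_map_self_eq_zero {K : Submodule ℂ H} {T : K →ₗ[ℂ] H}
    (h : ∀ φ : K, ⟪(φ : H), T φ⟫_ℂ = 0) (φ ψ : K) : ⟪(φ : H), T ψ⟫_ℂ = 0 := by
  have hadd := h (φ + ψ)
  have hadd_I := h (φ + Complex.I • ψ)
  simp only [map_add, map_smul, Submodule.coe_add, Submodule.coe_smul, inner_add_left,
    inner_add_right, inner_smul_left, inner_smul_right, h, Complex.conj_I] at hadd hadd_I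
  have hdiff : Complex.I * (⟪(φ : H), T ψ⟫_ℂ - ⟪(ψ : H), T φ⟫_ℂ) = 0 := by
    linear_combination hadd_I
  linear_combination (hadd + (mul_eq_zero.1 hdiff).resolve_left Complex.I_ne_zero) / 2

variable [CompleteSpace H]

theorem isFormalAdjoint_of_isSelfAdjoint {B : H →ₗ.[ℂ] H} (hB : IsSelfAdjoint B) :
    B.IsFormalAdjoint B := by
  have h := B.adjoint_isFormalAdjoint hB.dense_domain
  rwa [LinearPMap.isSelfAdjoint_def.1 hB] at h

namespace IsUnitaryGroupOf

variable {B : H →ₗ.[ℂ] H} {U V : ℝ → H →L[ℂ] H}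

theorem norm_apply (h : IsUnitaryGroupOf B U) (t : ℝ) (φ : H) : ‖U t φ‖ = ‖φ‖ :=
  ContinuousLinearMap.norm_map_of_mem_unitary (h.mem_unitary t) φ

theorem apply_add (h : IsUnitaryGroupOf B U) (s t : ℝ) (φ : H) :
    U (s + t) φ = U s (U t φ) := by
  rw [h.map_add, mul_apply_eq_comp]

theorem adjoint_eq (h : IsUnitaryGroupOf B U) (t : ℝ) :
    ContinuousLinearMap.adjoint (U t) = U (-t) := by
  refine left_inv_eq_right_inv (Unitary.mem_iff.1 (h.mem_unitary t)).1 ?_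
  rw [← h.map_add, add_neg_cancel, h.map_zero]

theorem inner_apply_left (h : IsUnitaryGroupOf B U) (t : ℝ) (φ ψ : H) :
    ⟪U t φ, ψ⟫_ℂ = ⟪φ, U (-t) ψ⟫_ℂ := by
  rw [← h.adjoint_eq, ContinuousLinearMap.adjoint_inner_right]

theorem hasDerivAt_zero (h : IsUnitaryGroupOf B U) (φ : B.domain) :
    HasDerivAt (fun t => U t φ) (Complex.I • B φ) 0 :=
  (h.generator _ _).1 (B.mem_graph φ)

theorem apply_mem_graph (h : IsUnitaryGroupOf B U) (φ : B.domain) (s : ℝ) :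
    (U s φ, U s (B φ)) ∈ B.graph := by
  have hcomm : (fun t => U t (U s φ)) = (U s).restrictScalars ℝ ∘ fun t => U t φ := by
    ext t
    change _ = U s (U t φ)
    rw [← h.apply_add, ← h.apply_add, add_comm]
  rw [h.generator, hcomm, ← map_smul]
  exact ((U s).restrictScalars ℝ).hasFDerivAt.comp_hasDerivAt (0 : ℝ) (h.hasDerivAt_zero φ)

theorem hasDerivAt (h : IsUnitaryGroupOf B U) (φ : B.domain) (s : ℝ) :
    HasDerivAt (fun t => U t φ) (Complex.I • U s (B φ)) s := by
  have hshift : (fun t => U t φ) = (U s).restrictScalars ℝ ∘ fun t => U (t - s) φ := by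
    ext t
    change _ = U s (U (t - s) φ)
    rw [← h.apply_add, add_sub_cancel]
  have hzero : HasDerivAt (fun t => U t φ) (Complex.I • B φ) (s - s) := by
    rw [sub_self]
    exact h.hasDerivAt_zero φ
  rw [hshift, ← map_smul]
  exact ((U s).restrictScalars ℝ).hasFDerivAt.comp_hasDerivAt s (hzero.comp_sub_const s s)

theorem inner_apply_apply_eq (hsymm : B.IsFormalAdjoint B) (hU : IsUnitaryGroupOf B U)
    (hV : IsUnitaryGroupOf B V) (φ ψ : B.domain) (t : ℝ) :
    ⟪U t φ, V t ψ⟫_ℂ = ⟪(φ : H), (ψ : H)⟫_ℂ := by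
  have hderiv : ∀ s, HasDerivAt (fun s => ⟪U s φ, V s ψ⟫_ℂ) 0 s := fun s => by
    refine ((hU.hasDerivAt φ s).inner ℂ (hV.hasDerivAt ψ s)).congr_deriv ?_
    obtain ⟨u, hu, hu'⟩ := (LinearPMap.mem_graph_iff _).1 (hU.apply_mem_graph φ s)
    obtain ⟨v, hv, hv'⟩ := (LinearPMap.mem_graph_iff _).1 (hV.apply_mem_graph ψ s)
    dsimp only at hu hu' hv hv'
    rw [← hu', ← hv', ← hu, ← hv, inner_smul_left, inner_smul_right, hsymm u v]
    simp
  have hconst := is_const_of_deriv_eq_zero (fun s => (hderiv s).differentiableAt)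
    (fun s => (hderiv s).deriv) t 0
  simpa only [hU.map_zero, hV.map_zero, one_apply_eq_self] using hconst

theorem unique (hdense : Dense (B.domain : Set H)) (hsymm : B.IsFormalAdjoint B)
    (hU : IsUnitaryGroupOf B U) (hV : IsUnitaryGroupOf B V) : U = V := by
  have eq_on_domain : ∀ (φ : B.domain) t, U t φ = V t φ := fun φ t => by
    refine sub_eq_zero.1 (norm_eq_zero.1 (pow_eq_zero_iff two_ne_zero |>.1 ?_))
    rw [norm_sub_sq (𝕜 := ℂ), inner_apply_apply_eq hsymm hU hV, hU.norm_apply, hV.norm_apply,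
      inner_self_eq_norm_sq]
    ring
  ext t φ
  exact congrFun (Continuous.ext_on hdense (U t).continuous (V t).continuous
    fun φ hφ => eq_on_domain ⟨φ, hφ⟩ t) φ

theorem expI (h : IsUnitaryGroupOf B U) : IsUnitaryGroupOf B (expI B) := by
  have hex : ∃ U : ℝ → H →L[ℂ] H, IsUnitaryGroupOf B U := ⟨U, h⟩
  have heq : Scattering.expI B = hex.choose := funext fun t => by rw [Scattering.expI, dif_pos hex]
  rw [heq]
  exact hex.choose_spec

end IsUnitaryGroupOf

/-- The character `x ↦ e^{itx}` of `ℝ`. -/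
def character (t x : ℝ) : ℂ := Complex.exp (Complex.I * (t * x : ℝ))

theorem norm_character (t x : ℝ) : ‖character t x‖ = 1 :=
  Complex.norm_exp_I_mul_ofReal _

theorem continuous_character : Continuous fun p : ℝ × ℝ => character p.1 p.2 := by
  unfold character
  fun_prop

theorem boundedMeasurable_character (t : ℝ) : BoundedMeasurable (character t) :=
  ⟨(continuous_character.comp (.prodMk_right t)).measurable, 1, fun x => (norm_character t x).le⟩

theorem character_add (s t : ℝ) : character (s + t) = character s * character t := by
  ext x
  rw [Pi.mul_apply, character, character, character, ← Complex.exp_add, add_mul,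
    Complex.ofReal_add, mul_add]

theorem character_zero : character 0 = 1 := by
  ext x
  simp [character]

theorem conj_character (t x : ℝ) : (starRingEnd ℂ) (character t x) = character (-t) x := by
  simp only [character, ← Complex.exp_conj, map_mul, Complex.conj_I, Complex.conj_ofReal]
  congr 1
  push_cast
  ring

theorem hasDerivAt_character (x : ℝ) :
    HasDerivAt (fun t => character t x) (Complex.I * x) 0 := by
  have := ((((hasDerivAt_id (0 : ℝ)).mul_const x).ofReal_comp).const_mul Complex.I).cexp
  simpa [character] using this

theorem norm_slope_character_le (t x : ℝ) : ‖slope (fun s => character s x) 0 t‖ ≤ |x| := by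
  have hexp : ‖character t x - 1‖ ≤ |t| * |x| := by
    simpa only [character, Real.norm_eq_abs, abs_mul] using
      Real.norm_exp_I_mul_ofReal_sub_one_le (x := t * x)
  rw [slope, vsub_eq_sub, sub_zero, character_zero, Pi.one_apply, norm_smul, norm_inv,
    Real.norm_eq_abs]
  exact inv_mul_le_of_le_mul₀ (abs_nonneg t) (abs_nonneg x) hexp

theorem norm_slope_character_sub_le (t x : ℝ) :
    ‖slope (fun s => character s x) 0 t - Complex.I * x‖ ≤ 2 * |x| := by
  have hlin : ‖Complex.I * (x : ℂ)‖ = |x| := by simp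
  linarith [norm_sub_le (slope (fun s => character s x) 0 t) (Complex.I * x),
    norm_slope_character_le t x]

namespace ProjMeasure

variable (E : ProjMeasure H)

/-- The unitary operator `∫ e^{itλ} dE_λ`. -/
def unitaryGroup (t : ℝ) : H →L[ℂ] H := E.calculus.op (character t)

theorem represents_unitaryGroup (t : ℝ) (φ : H) :
    E.calculus.Represents φ (character t) (E.unitaryGroup t φ) :=
  E.calculus.represents_op (boundedMeasurable_character t) φ

theorem unitaryGroup_add (s t : ℝ) :
    E.unitaryGroup (s + t) = E.unitaryGroup s * E.unitaryGroup t := by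
  rw [unitaryGroup, character_add]
  exact E.calculus.op_mul (boundedMeasurable_character s) (boundedMeasurable_character t)

theorem unitaryGroup_zero : E.unitaryGroup 0 = 1 := by
  rw [unitaryGroup, character_zero, E.calculus.op_one]

theorem star_unitaryGroup (t : ℝ) : star (E.unitaryGroup t) = E.unitaryGroup (-t) := by
  rw [ContinuousLinearMap.star_eq_adjoint, unitaryGroup,
    ← E.calculus.op_conj (boundedMeasurable_character t)]
  simp only [conj_character]
  rfl

theorem unitaryGroup_mem_unitary (t : ℝ) : E.unitaryGroup t ∈ unitary (H →L[ℂ] H) := by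
  rw [Unitary.mem_iff, E.star_unitaryGroup, ← E.unitaryGroup_add, ← E.unitaryGroup_add,
    neg_add_cancel, add_neg_cancel, E.unitaryGroup_zero]
  exact ⟨rfl, rfl⟩

theorem continuous_unitaryGroup (φ : H) : Continuous fun t => E.unitaryGroup t φ := by
  refine continuous_iff_continuousAt.2 fun s => L2Calculus.Represents.tendsto_of_dominated
    (fun t => E.represents_unitaryGroup t φ) (E.represents_unitaryGroup s φ)
    (memLp_const (2 : ℝ)) (fun t x => ?_) fun x => ?_
  · linarith [norm_sub_le (character t x) (character s x), norm_character t x, norm_character s x]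
  · exact (continuous_character.comp (.prodMk_left x)).tendsto s

theorem represents_slope_unitaryGroup (φ : H) (t : ℝ) :
    E.calculus.Represents φ (fun x => slope (fun s => character s x) 0 t)
      (slope (fun s => E.unitaryGroup s φ) 0 t) := by
  have := ((E.represents_unitaryGroup t φ).sub (E.represents_unitaryGroup 0 φ)).smul
    (((t - 0 : ℝ)⁻¹ : ℝ) : ℂ)
  simp only [slope, vsub_eq_sub, ← Complex.coe_smul]
  exact this

theorem hasDerivAt_unitaryGroup {φ ψ : H}
    (h : E.calculus.Represents φ (fun x : ℝ => Complex.I * x) ψ) :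
    HasDerivAt (fun t => E.unitaryGroup t φ) ψ 0 := by
  refine hasDerivAt_iff_tendsto_slope.2 (L2Calculus.Represents.tendsto_of_dominated
    (E.represents_slope_unitaryGroup φ) h (b := fun x => 2 * |x|) ?_
    (fun t x => norm_slope_character_sub_le t x)
    fun x => hasDerivAt_iff_tendsto_slope.1 (hasDerivAt_character x))
  simpa using h.memLp.norm.const_mul 2

theorem memLp_of_hasDerivAt_unitaryGroup {φ ψ : H}
    (h : HasDerivAt (fun t => E.unitaryGroup t φ) ψ 0) :
    MemLp (fun x : ℝ => Complex.I * x) 2 (E.scalar φ) := by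
  obtain ⟨t, ht⟩ := (𝓝[≠] (0 : ℝ)).exists_seq_tendsto
  exact L2Calculus.Represents.memLp_of_tendsto
    (fun n => E.represents_slope_unitaryGroup φ (t n))
    (fun x => (hasDerivAt_iff_tendsto_slope.1 (hasDerivAt_character x)).comp ht)
    ((hasDerivAt_iff_tendsto_slope.1 h).comp ht)

end ProjMeasure

namespace IsSpectralMeasureOf

variable {B : H →ₗ.[ℂ] H} {E : ProjMeasure H}

theorem mem_domain_iff_memLp (h : IsSpectralMeasureOf B E) (φ : H) :
    φ ∈ B.domain ↔ MemLp (fun x : ℝ => Complex.I * x) 2 (E.scalar φ) := by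
  rw [h.mem_domain_iff, memLp_two_iff_lintegral_ofReal_sq_lt_top (l := id) (by fun_prop)
    fun x => by simp]
  rfl

theorem represents_generator (h : IsSpectralMeasureOf B E) (hdense : Dense (B.domain : Set H))
    (φ : B.domain) : E.calculus.Represents φ (fun x : ℝ => Complex.I * x) (Complex.I • B φ) := by
  choose L hL using fun φ : B.domain =>
    (⟨_, E.calculus.represents_vector _ ((h.mem_domain_iff_memLp φ).1 φ.2)⟩ :
      ∃ ψ, E.calculus.Represents (φ : H) (fun x : ℝ => Complex.I * x) ψ)
  have hderiv := fun φ => E.hasDerivAt_unitaryGroup (hL φ)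
  let T : B.domain →ₗ[ℂ] H := IsLinearMap.mk' L
    { map_add := fun φ ψ => (hderiv (φ + ψ)).unique <| by
        simp only [Submodule.coe_add, _root_.map_add]
        exact (hderiv φ).add (hderiv ψ)
      map_smul := fun c φ => (hderiv (c • φ)).unique <| by
        simp only [Submodule.coe_smul, map_smul]
        exact (hderiv φ).const_smul c }
  have hT : ∀ φ : B.domain, ⟪(φ : H), (T - Complex.I • B.toFun) φ⟫_ℂ = 0 := fun φ => by
    change ⟪(φ : H), L φ - Complex.I • B φ⟫_ℂ = 0
    rw [inner_sub_right, inner_smul_right, h.inner_apply, (hL φ).inner_left_eq,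
      MeasureTheory.integral_const_mul, integral_complex_ofReal]
    exact sub_self _
  have heq : L φ = Complex.I • B φ := sub_eq_zero.1 <| hdense.eq_zero_of_inner_right ℂ
    fun v hv => inner_map_eq_zero_of_inner_map_self_eq_zero hT ⟨v, hv⟩ φ
  exact heq ▸ hL φ

theorem isUnitaryGroupOf (h : IsSpectralMeasureOf B E) (hdense : Dense (B.domain : Set H)) :
    IsUnitaryGroupOf B E.unitaryGroup where
  mem_unitary := E.unitaryGroup_mem_unitary
  map_zero := E.unitaryGroup_zero
  map_add := E.unitaryGroup_add
  continuous := E.continuous_unitaryGroup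
  generator φ ψ := by
    have hderiv := fun φ => E.hasDerivAt_unitaryGroup (h.represents_generator hdense φ)
    refine ⟨fun hgraph => ?_, fun hψ => ?_⟩
    · obtain ⟨u, rfl, rfl⟩ := (LinearPMap.mem_graph_iff _).1 hgraph
      exact hderiv u
    · let u : B.domain := ⟨φ, (h.mem_domain_iff_memLp φ).2 (E.memLp_of_hasDerivAt_unitaryGroup hψ)⟩
      exact (LinearPMap.mem_graph_iff _).2
        ⟨u, rfl, smul_right_injective H Complex.I_ne_zero ((hderiv u).unique hψ)⟩

theorem expI_eq (h : IsSpectralMeasureOf B E) (hB : IsSelfAdjoint B) :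
    expI B = E.unitaryGroup :=
  have hgroup := h.isUnitaryGroupOf hB.dense_domain
  hgroup.expI.unique hB.dense_domain (isFormalAdjoint_of_isSelfAdjoint hB) hgroup

end IsSpectralMeasureOf

end UnitaryGroup

section SpectralTheorem

variable {H : Type*} [NormedAddCommGroup H] [InnerProductSpace ℂ H]

/-- `R = (A + c)⁻¹` as a bounded, everywhere defined operator. -/
structure IsResolvent (A : H →ₗ.[ℂ] H) (c : ℂ) (R : H →L[ℂ] H) : Prop where
  mem_graph : ∀ ψ, (R ψ, ψ - c • R ψ) ∈ A.graph
  apply_add_smul : ∀ φ : A.domain, R (A φ + c • (φ : H)) = φ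

namespace IsResolvent

variable {A : H →ₗ.[ℂ] H} {c d : ℂ} {R Q : H →L[ℂ] H}

theorem exists_domain_eq (hR : IsResolvent A c R) (ψ : H) :
    ∃ u : A.domain, R ψ = u ∧ ψ = A u + c • (u : H) := by
  obtain ⟨u, hu, hAu⟩ := (LinearPMap.mem_graph_iff _).1 (hR.mem_graph ψ)
  simp only at hu hAu
  exact ⟨u, hu.symm, by rw [hAu, hu, sub_add_cancel]⟩

theorem injective (hR : IsResolvent A c R) : Function.Injective R := by
  refine (injective_iff_map_eq_zero R).2 fun ψ hψ => ?_
  have h := hR.mem_graph ψ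
  rw [hψ, smul_zero, sub_zero] at h
  exact A.graph_fst_eq_zero_snd h rfl

theorem sub_eq (hR : IsResolvent A c R) (hQ : IsResolvent A d Q) :
    R - Q = (d - c) • (Q * R) := by
  ext ψ
  obtain ⟨u, hRu, hψ⟩ := hR.exists_domain_eq ψ
  have hQψ : Q ψ = u + (c - d) • Q u := by
    rw [← hQ.apply_add_smul u, ← map_smul, ← map_add, hψ]
    congr 1
    rw [hQ.apply_add_smul]
    module
  simp only [sub_apply, smul_apply, mul_apply_eq_comp, hRu, hQψ]
  module

variable [CompleteSpace H]

theorem star_eq (hA : A.IsFormalAdjoint A) (hR : IsResolvent A c R)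
    (hQ : IsResolvent A ((starRingEnd ℂ) c) Q) : star R = Q := by
  rw [ContinuousLinearMap.star_eq_adjoint]
  refine ((ContinuousLinearMap.eq_adjoint_iff _ _).2 fun x y => ?_).symm
  obtain ⟨u, hu, hx⟩ := hQ.exists_domain_eq x
  obtain ⟨v, hv, hy⟩ := hR.exists_domain_eq y
  rw [hu, hv, hx, hy, inner_add_right, inner_add_left, inner_smul_left, inner_smul_right, hA,
    Complex.conj_conj]

theorem isStarNormal (hA : A.IsFormalAdjoint A) (hc : (starRingEnd ℂ) c ≠ c)
    (hR : IsResolvent A c R) (hQ : IsResolvent A ((starRingEnd ℂ) c) Q) : IsStarNormal R := by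
  refine ⟨?_⟩
  rw [hR.star_eq hA hQ, commute_iff_eq]
  refine smul_right_injective _ (sub_ne_zero.2 hc) ?_
  change ((starRingEnd ℂ) c - c) • (Q * R) = ((starRingEnd ℂ) c - c) • (R * Q)
  rw [← hR.sub_eq hQ, ← neg_sub c, neg_smul, ← hQ.sub_eq hR, neg_sub]

end IsResolvent

section Shift

variable {A : H →ₗ.[ℂ] H} {c : ℂ}

theorem norm_apply_add_smul_sq (hA : A.IsFormalAdjoint A) (hc : (starRingEnd ℂ) c = -c)
    (φ : A.domain) : ‖A φ + c • (φ : H)‖ ^ 2 = ‖A φ‖ ^ 2 + (‖c‖ * ‖(φ : H)‖) ^ 2 := by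
  have hconj : (starRingEnd ℂ) ⟪A φ, c • (φ : H)⟫_ℂ = -⟪A φ, c • (φ : H)⟫_ℂ := by
    rw [inner_conj_symm, inner_smul_left, inner_smul_right, hc, hA]
    ring
  have hre : (⟪A φ, c • (φ : H)⟫_ℂ).re = 0 := by
    have := congrArg Complex.re hconj
    rw [Complex.conj_re, Complex.neg_re] at this
    linarith
  rw [norm_add_sq (𝕜 := ℂ), norm_smul, RCLike.re_to_complex, hre, mul_zero, add_zero]

variable (A c) in
/-- The map `(φ, A φ) ↦ A φ + c φ` on the graph of `A`, whose inverse gives the resolvent. -/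
def shift : A.graph →L[ℂ] H :=
  (ContinuousLinearMap.snd ℂ H H + c • ContinuousLinearMap.fst ℂ H H).comp A.graph.subtypeL

theorem norm_le_norm_shift (hA : A.IsFormalAdjoint A) (hc : (starRingEnd ℂ) c = -c) (hc₀ : c ≠ 0)
    (p : A.graph) : ‖p‖ ≤ max 1 ‖c‖⁻¹ * ‖shift A c p‖ := by
  obtain ⟨⟨x, y⟩, hp⟩ := p
  obtain ⟨φ, rfl, rfl⟩ := (LinearPMap.mem_graph_iff _).1 hp
  change max ‖(φ : H)‖ ‖A φ‖ ≤ max 1 ‖c‖⁻¹ * ‖A φ + c • (φ : H)‖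
  have hsq := norm_apply_add_smul_sq hA hc φ
  have hφ : ‖c‖ * ‖(φ : H)‖ ≤ ‖A φ + c • (φ : H)‖ :=
    (sq_le_sq₀ (by positivity) (norm_nonneg _)).1 (hsq ▸ le_add_of_nonneg_left (sq_nonneg _))
  have hAφ : ‖A φ‖ ≤ ‖A φ + c • (φ : H)‖ :=
    (sq_le_sq₀ (norm_nonneg _) (norm_nonneg _)).1 (hsq ▸ le_add_of_nonneg_right (sq_nonneg _))
  refine max_le ?_ ?_
  · calc ‖(φ : H)‖ ≤ ‖c‖⁻¹ * ‖A φ + c • (φ : H)‖ := by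
          rwa [le_inv_mul_iff₀ (norm_pos_iff.2 hc₀)]
      _ ≤ max 1 ‖c‖⁻¹ * ‖A φ + c • (φ : H)‖ := by gcongr; exact le_max_right _ _
  · calc ‖A φ‖ ≤ 1 * ‖A φ + c • (φ : H)‖ := by rwa [one_mul]
      _ ≤ max 1 ‖c‖⁻¹ * ‖A φ + c • (φ : H)‖ := by gcongr; exact le_max_left _ _

theorem antilipschitz_shift (hA : A.IsFormalAdjoint A) (hc : (starRingEnd ℂ) c = -c)
    (hc₀ : c ≠ 0) : AntilipschitzWith (max 1 ‖c‖₊⁻¹) (shift A c) :=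
  (shift A c).antilipschitz_of_bound fun p => by simpa using norm_le_norm_shift hA hc hc₀ p

variable [CompleteSpace H]

theorem mem_graph_of_forall_inner_eq (hA : IsSelfAdjoint A) {η χ : H}
    (h : ∀ φ : A.domain, ⟪χ, (φ : H)⟫_ℂ = ⟪η, A φ⟫_ℂ) : (η, χ) ∈ A.graph := by
  have hη : η ∈ A.adjoint.domain := LinearPMap.mem_adjoint_domain_of_exists η ⟨χ, h⟩
  have hχ : A.adjoint ⟨η, hη⟩ = χ := LinearPMap.adjoint_apply_eq hA.dense_domain ⟨η, hη⟩ h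
  have hgraph : (η, χ) ∈ A.adjoint.graph := (LinearPMap.mem_graph_iff _).2 ⟨⟨η, hη⟩, rfl, hχ⟩
  rwa [LinearPMap.isSelfAdjoint_def.1 hA] at hgraph

theorem eq_zero_of_forall_inner_shift_eq_zero (hA : IsSelfAdjoint A)
    (hc : (starRingEnd ℂ) c = -c) (hc₀ : c ≠ 0) {η : H} (h : ∀ p, ⟪η, shift A c p⟫_ℂ = 0) :
    η = 0 := by
  have hη : (η, c • η) ∈ A.graph := mem_graph_of_forall_inner_eq hA fun φ => by
    have hφ : ⟪η, A φ + c • (φ : H)⟫_ℂ = 0 := h ⟨(φ, A φ), A.mem_graph φ⟩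
    rw [inner_add_right, inner_smul_right] at hφ
    rw [inner_smul_left, hc]
    linear_combination -hφ
  have hker : shift A (-c) ⟨(η, c • η), hη⟩ = 0 := by
    change c • η + (-c) • η = 0
    module
  have hp := (antilipschitz_shift (isFormalAdjoint_of_isSelfAdjoint hA) (by rw [map_neg, hc])
    (neg_ne_zero.2 hc₀)).injective (hker.trans (map_zero _).symm)
  exact congrArg (fun p : A.graph => (p : H × H).1) hp

theorem range_shift_eq_top (hA : IsSelfAdjoint A) (hc : (starRingEnd ℂ) c = -c) (hc₀ : c ≠ 0) :
    (shift A c).range = ⊤ := by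
  have : CompleteSpace A.graph := hA.isClosed.completeSpace_coe
  have hclosed : IsClosed ((shift A c).range : Set H) :=
    (antilipschitz_shift (isFormalAdjoint_of_isSelfAdjoint hA) hc hc₀).isClosed_range
      (shift A c).uniformContinuous
  have : CompleteSpace (shift A c).range := hclosed.completeSpace_coe
  rw [← Submodule.orthogonal_eq_bot_iff, Submodule.eq_bot_iff]
  exact fun η hη => eq_zero_of_forall_inner_shift_eq_zero hA hc hc₀ fun p =>
    (Submodule.mem_orthogonal' _ _).1 hη _ ⟨p, rfl⟩

theorem exists_isResolvent (hA : IsSelfAdjoint A) (hc : (starRingEnd ℂ) c = -c) (hc₀ : c ≠ 0) :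
    ∃ R, IsResolvent A c R := by
  have : CompleteSpace A.graph := hA.isClosed.completeSpace_coe
  let e := ContinuousLinearEquiv.ofBijective (shift A c) (LinearMap.ker_eq_bot.2
    (antilipschitz_shift (isFormalAdjoint_of_isSelfAdjoint hA) hc hc₀).injective)
    (range_shift_eq_top hA hc hc₀)
  refine ⟨(ContinuousLinearMap.fst ℂ H H).comp (A.graph.subtypeL.comp (e.symm : H →L[ℂ] A.graph)),
    fun ψ => ?_, fun φ => ?_⟩
  · have hψ : ((e.symm ψ : A.graph) : H × H).2 + c • ((e.symm ψ : A.graph) : H × H).1 = ψ :=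
      e.apply_symm_apply ψ
    change (((e.symm ψ : A.graph) : H × H).1, ψ - c • ((e.symm ψ : A.graph) : H × H).1) ∈ A.graph
    rw [← eq_sub_of_add_eq hψ]
    exact (e.symm ψ).2
  · exact congrArg (fun p : A.graph => (p : H × H).1)
      (e.symm_apply_apply ⟨(φ, A φ), A.mem_graph φ⟩)

end Shift

variable [CompleteSpace H]

namespace ProjMeasure

variable {X D : Type*} [MeasurableSpace X] [AddCommGroup D] [Module ℂ D] (F : L2Calculus H X D)
  {l : X → ℝ}

open Classical in
/-- The projection-valued measure `S ↦ χ_S(l)` obtained by pushing the calculus `F` forward along a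
real symbol `l`, which may be unbounded. -/
def ofCalculus (hl : Measurable l) : ProjMeasure H where
  proj S := if MeasurableSet S then F.op ((l ⁻¹' S).indicator 1) else 0
  isStarProjection S hS := by
    rw [if_pos hS]
    exact F.isStarProjection_op_indicator (hl hS)
  not_measurable S hS := if_neg hS
  empty := by
    rw [if_pos MeasurableSet.empty, preimage_empty, indicator_empty']
    exact F.op_zero
  univ := by
    rw [if_pos MeasurableSet.univ, preimage_univ, indicator_univ, F.op_one]
  hasSum_iUnion S hS hd φ := by
    simp only [if_pos (hS _), if_pos (MeasurableSet.iUnion hS), preimage_iUnion]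
    exact F.hasSum_op_indicator (fun n => hl (hS n)) (fun m n hmn => (hd hmn).preimage l) φ

theorem scalar_ofCalculus (hl : Measurable l) (φ : H) :
    (ofCalculus F hl).scalar φ = (F.measure φ).map l := by
  ext S hS
  rw [Measure.map_apply hl hS, scalar_apply_eq_enorm_sq _ _ hS, ← F.enorm_op_indicator_sq (hl hS)]
  simp only [ofCalculus, if_pos hS]

end ProjMeasure

section NormalCalculus

open scoped CompactlySupported

/-- A real continuous function, regarded as a complex one. -/
def complexify {K : Type*} [TopologicalSpace K] (f : C(K, ℝ)) : C(K, ℂ) :=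
  ⟨fun x => (f x : ℂ), by fun_prop⟩

theorem star_complexify_mul_self {K : Type*} [TopologicalSpace K] (d : C(K, ℂ)) :
    star d * d = complexify ⟨fun x => ‖d x‖ ^ 2, by fun_prop⟩ := by
  ext x
  simp [complexify, Complex.conj_mul']

theorem complexify_eq_star_sqrt_mul_sqrt {K : Type*} [TopologicalSpace K] {f : C(K, ℝ)}
    (hf : 0 ≤ f) : complexify f = star (complexify ⟨fun x => √(f x), by fun_prop⟩) *
      complexify ⟨fun x => √(f x), by fun_prop⟩ := by
  ext x
  have hx : √(f x) * √(f x) = f x := Real.mul_self_sqrt (hf x)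
  simp [complexify, ← Complex.ofReal_mul, hx]

theorem boundedMeasurable_continuousMap {K : Type*} [TopologicalSpace K] [CompactSpace K]
    [MeasurableSpace K] [BorelSpace K] (d : C(K, ℂ)) : BoundedMeasurable d :=
  ⟨d.continuous.measurable, ‖d‖, d.norm_coe_le_norm⟩

variable (R : H →L[ℂ] H) [hR : IsStarNormal R]

theorem norm_cfcHom_sq (d : C(spectrum ℂ R, ℂ)) (φ : H) :
    ‖cfcHom hR d φ‖ ^ 2 = (⟪φ, cfcHom hR (star d * d) φ⟫_ℂ).re := by
  rw [map_mul, map_star, mul_apply_eq_comp, ContinuousLinearMap.star_eq_adjoint,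
    ContinuousLinearMap.adjoint_inner_right, inner_self_eq_norm_sq_to_K]
  norm_cast

/-- The positive functional `f ↦ (φ, f(R) φ)` on continuous functions on the spectrum of the normal
operator `R`; it represents the spectral measure of `φ`. -/
def spectralFunctional (φ : H) : C_c(spectrum ℂ R, ℝ) →ₚ[ℝ] ℝ :=
  PositiveLinearMap.mk₀
    { toFun := fun f => (⟪φ, cfcHom hR (complexify (f : C(spectrum ℂ R, ℝ))) φ⟫_ℂ).re
      map_add' := fun f g => by
        have hfg : complexify ((f + g : C_c(spectrum ℂ R, ℝ)) : C(spectrum ℂ R, ℝ)) =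
            complexify (f : C(spectrum ℂ R, ℝ)) + complexify (g : C(spectrum ℂ R, ℝ)) := by
          ext x
          simp [complexify]
        rw [hfg, map_add, add_apply, inner_add_right, Complex.add_re]
      map_smul' := fun c f => by
        have hcf : complexify ((c • f : C_c(spectrum ℂ R, ℝ)) : C(spectrum ℂ R, ℝ)) =
            (c : ℂ) • complexify (f : C(spectrum ℂ R, ℝ)) := by
          ext x
          simp [complexify]
        rw [hcf, map_smul, smul_apply, inner_smul_right, Complex.re_ofReal_mul]
        rfl }
    fun f hf => by
      change 0 ≤ (⟪φ, cfcHom hR (complexify (f : C(spectrum ℂ R, ℝ))) φ⟫_ℂ).re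
      rw [complexify_eq_star_sqrt_mul_sqrt (f := (f : C(spectrum ℂ R, ℝ))) hf, ← norm_cfcHom_sq]
      positivity

theorem enorm_cfcHom_apply (d : C(spectrum ℂ R, ℂ)) (φ : H) :
    ‖cfcHom hR d φ‖ₑ = eLpNorm d 2 (RealRMK.rieszMeasure (spectralFunctional R φ)) := by
  refine enorm_eq_eLpNorm_two ?_
  let f : C_c(spectrum ℂ R, ℝ) :=
    ⟨⟨fun x => ‖d x‖ ^ 2, by fun_prop⟩, HasCompactSupport.of_compactSpace _⟩
  have hnorm : ‖cfcHom hR d φ‖ ^ 2 =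
      ∫ x, f x ∂(RealRMK.rieszMeasure (spectralFunctional R φ)) := by
    rw [RealRMK.integral_rieszMeasure, norm_cfcHom_sq, star_complexify_mul_self]
    rfl
  have hf : Integrable f (RealRMK.rieszMeasure (spectralFunctional R φ)) :=
    f.continuous.integrable_of_hasCompactSupport f.hasCompactSupport
  rw [← ofReal_norm, ← ENNReal.ofReal_pow (norm_nonneg _), hnorm,
    ofReal_integral_eq_lintegral_ofReal hf (ae_of_all _ fun x => sq_nonneg ‖d x‖)]
  refine lintegral_congr fun x => ?_
  rw [← ofReal_norm, ← ENNReal.ofReal_pow (norm_nonneg _)]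
  rfl

/-- The continuous functional calculus of a normal operator. -/
def normalCalculus : L2Calculus H (spectrum ℂ R) C(spectrum ℂ R, ℂ) where
  measure φ := RealRMK.rieszMeasure (spectralFunctional R φ)
  eval := ContinuousMap.coeFnLinearMap ℂ
  toOp := (cfcHom hR : C(spectrum ℂ R, ℂ) →⋆ₐ[ℂ] (H →L[ℂ] H)).toAlgHom.toLinearMap
  isFiniteMeasure φ := inferInstance
  boundedMeasurable := boundedMeasurable_continuousMap
  exists_eLpNorm_sub_le ν _ f hf ε hε := by
    obtain ⟨g, hg, -⟩ := hf.exists_boundedContinuous_eLpNorm_sub_le (by norm_num) hε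
    exact ⟨g.toContinuousMap, hg⟩
  enorm_toOp := enorm_cfcHom_apply R
  exists_one := ⟨1, rfl, map_one (cfcHom hR)⟩

theorem normalCalculus_op_coe : (normalCalculus R).op (fun z => (z : ℂ)) = R :=
  ((normalCalculus R).op_eval ((ContinuousMap.id ℂ).restrict (spectrum ℂ R))).trans (cfcHom_id hR)

end NormalCalculus

theorem L2Calculus.measure_eq_zero_of_injective_op {X D : Type*} [MeasurableSpace X]
    [AddCommGroup D] [Module ℂ D] (F : L2Calculus H X D) {r : X → ℂ} (hr : BoundedMeasurable r)
    (hinj : Function.Injective (F.op r)) (φ : H) : F.measure φ {x | r x = 0} = 0 := by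
  have hS : MeasurableSet {x | r x = 0} := hr.measurable (measurableSet_singleton 0)
  have hmul : r * {x | r x = 0}.indicator 1 = 0 := by
    ext x
    by_cases hx : r x = 0 <;> simp [hx]
  have hzero : F.op r (F.op ({x | r x = 0}.indicator 1) φ) = 0 := by
    rw [← mul_apply_eq_comp, ← F.op_mul hr (.indicator_one hS), hmul, F.op_zero, zero_apply]
  rw [← F.enorm_op_indicator_sq hS, hinj (hzero.trans (map_zero _).symm)]
  simp

section ResolventSymbol

variable {A : H →ₗ.[ℂ] H} {X D : Type*} [MeasurableSpace X] [AddCommGroup D] [Module ℂ D]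
  {F : L2Calculus H X D} {r : X → ℂ} {l : X → ℝ}

theorem exists_mem_graph_represents (hr : BoundedMeasurable r)
    (hR : IsResolvent A Complex.I (F.op r)) (hrl : ∀ x, r x ≠ 0 → r x * (l x + Complex.I) = 1)
    {φ : H} (hφ : MemLp (fun x => (l x : ℂ)) 2 (F.measure φ)) :
    ∃ χ, (φ, χ) ∈ A.graph ∧ F.Represents φ (fun x => (l x : ℂ)) χ := by
  have hψ := F.represents_vector φ (hφ.add (memLp_const Complex.I))
  set ψ := F.vector φ (hφ.add (memLp_const Complex.I)).toLp
  have hRψ : F.op r ψ = φ := by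
    refine ((hψ.op hr).congr_ae ?_).unique (F.represents_one φ)
    have hne : ∀ᵐ x ∂F.measure φ, r x ≠ 0 := by
      simpa only [ae_iff, ne_eq, not_not] using F.measure_eq_zero_of_injective_op hr hR.injective φ
    filter_upwards [hne] with x hx using hrl x hx
  refine ⟨ψ - Complex.I • φ, ?_, ?_⟩
  · simpa only [hRψ] using hR.mem_graph ψ
  · refine (hψ.sub ((F.represents_one φ).smul Complex.I)).congr_ae (ae_of_all _ fun x => ?_)
    simp

theorem memLp_of_mem_domain (hr : BoundedMeasurable r) (hl : Measurable l)
    (hR : IsResolvent A Complex.I (F.op r)) (hrl : ∀ x, r x ≠ 0 → r x * (l x + Complex.I) = 1)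
    (φ : A.domain) : MemLp (fun x => (l x : ℂ)) 2 (F.measure φ) := by
  have hbound : ∀ x, ‖r x‖ₑ ^ 2 * ‖(l x : ℂ)‖ₑ ^ 2 ≤ 1 := fun x => by
    rw [← mul_pow, ← enorm_mul]
    refine pow_le_one₀ zero_le ?_
    rw [← ofReal_norm, ENNReal.ofReal_le_one]
    rcases eq_or_ne (r x) 0 with hx | hx
    · simp [hx]
    · calc ‖r x * l x‖ ≤ ‖r x * (l x + Complex.I)‖ := by
            rw [norm_mul, norm_mul]
            gcongr
            simpa using Complex.abs_re_le_norm (l x + Complex.I)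
        _ = 1 := by rw [hrl x hx, norm_one]
  have hmeas : Measurable fun x => (l x : ℂ) := Complex.measurable_ofReal.comp hl
  refine ⟨hmeas.aestronglyMeasurable, (ENNReal.pow_lt_top_iff.1 ?_).resolve_right two_ne_zero⟩
  rw [← hR.apply_add_smul φ, F.measure_op hr, eLpNorm_two_sq,
    lintegral_withDensity_eq_lintegral_mul _ (hr.measurable.enorm.pow_const 2)
      (hmeas.enorm.pow_const 2)]
  calc ∫⁻ x, ‖r x‖ₑ ^ 2 * ‖(l x : ℂ)‖ₑ ^ 2 ∂_ ≤ ∫⁻ _, 1 ∂_ := lintegral_mono hbound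
    _ < ∞ := by simp

theorem isSpectralMeasureOf_ofCalculus (hr : BoundedMeasurable r) (hl : Measurable l)
    (hR : IsResolvent A Complex.I (F.op r)) (hrl : ∀ x, r x ≠ 0 → r x * (l x + Complex.I) = 1) :
    IsSpectralMeasureOf A (ProjMeasure.ofCalculus F hl) := by
  refine ⟨fun φ => ?_, fun φ => ?_⟩
  · rw [ProjMeasure.scalar_ofCalculus, lintegral_map (by fun_prop) hl,
      ← memLp_two_iff_lintegral_ofReal_sq_lt_top (f := fun x => (l x : ℂ))
        (Complex.measurable_ofReal.comp hl).aestronglyMeasurable fun x => by simp]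
    refine ⟨fun hφ => memLp_of_mem_domain hr hl hR hrl ⟨φ, hφ⟩, fun hφ => ?_⟩
    obtain ⟨χ, hgraph, -⟩ := exists_mem_graph_represents hr hR hrl hφ
    exact A.mem_domain_of_mem_graph hgraph
  · obtain ⟨χ, hgraph, hχ⟩ :=
      exists_mem_graph_represents hr hR hrl (memLp_of_mem_domain hr hl hR hrl φ)
    rw [← A.mem_graph_snd_inj (A.mem_graph φ) hgraph rfl] at hχ
    rw [hχ.inner_left_eq, ProjMeasure.scalar_ofCalculus,
      integral_map (f := fun x : ℝ => x) hl.aemeasurable aestronglyMeasurable_id,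
      integral_complex_ofReal]

end ResolventSymbol

theorem im_eq_neg_norm_sq_of_mem_spectrum {R : H →L[ℂ] H} [hR : IsStarNormal R]
    (h : R - star R = (-2 * Complex.I) • (star R * R)) {z : ℂ} (hz : z ∈ spectrum ℂ R) :
    z.im = -‖z‖ ^ 2 := by
  let ι : C(spectrum ℂ R, ℂ) := (ContinuousMap.id ℂ).restrict (spectrum ℂ R)
  have hι : ι - star ι = (-2 * Complex.I) • (star ι * ι) := by
    refine cfcHom_injective hR ?_
    rw [map_sub, map_smul, map_mul, map_star, cfcHom_id hR, h]
  have hz' : z - (starRingEnd ℂ) z = (-2 * Complex.I) * ((starRingEnd ℂ) z * z) :=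
    congrArg (fun f : C(spectrum ℂ R, ℂ) => f ⟨z, hz⟩) hι
  have him := congrArg Complex.im hz'
  rw [Complex.conj_mul', ← Complex.ofReal_pow, Complex.im_mul_ofReal, Complex.sub_im,
    Complex.conj_im] at him
  simp only [Complex.mul_im, Complex.neg_re, Complex.neg_im, Complex.I_re, Complex.I_im,
    Complex.re_ofNat, Complex.im_ofNat] at him
  linarith

theorem exists_isSpectralMeasureOf {A : H →ₗ.[ℂ] H} (hA : IsSelfAdjoint A) :
    ∃ E : ProjMeasure H, IsSpectralMeasureOf A E := by
  have hsymm := isFormalAdjoint_of_isSelfAdjoint hA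
  obtain ⟨R, hR⟩ := exists_isResolvent hA Complex.conj_I Complex.I_ne_zero
  obtain ⟨Q, hQ⟩ := exists_isResolvent hA (c := (starRingEnd ℂ) Complex.I) (by simp) (by simp)
  have hnormal : IsStarNormal R := hR.isStarNormal hsymm (by simp [neg_eq_self]) hQ
  refine ⟨_, isSpectralMeasureOf_ofCalculus (F := normalCalculus R)
    (boundedMeasurable_continuousMap ((ContinuousMap.id ℂ).restrict (spectrum ℂ R)))
    (l := fun z => ((z : ℂ)⁻¹).re) (Complex.measurable_re.comp measurable_subtype_coe.inv)
    ((normalCalculus_op_coe R).symm ▸ hR) fun z hz => ?_⟩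
  change (z : ℂ) ≠ 0 at hz
  have hRR : R - star R = (-2 * Complex.I) • (star R * R) := by
    rw [hR.star_eq hsymm hQ, hR.sub_eq hQ, Complex.conj_I]
    ring_nf
  have him : ((z : ℂ)⁻¹).im = 1 := by
    rw [Complex.inv_im, im_eq_neg_norm_sq_of_mem_spectrum hRR z.2, neg_neg,
      Complex.normSq_eq_norm_sq, div_self (pow_ne_zero 2 (norm_ne_zero_iff.2 hz))]
  have hinv : (z : ℂ)⁻¹ = ((z : ℂ)⁻¹).re + Complex.I := by
    conv_lhs => rw [← Complex.re_add_im (z : ℂ)⁻¹, him, Complex.ofReal_one, one_mul]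
  exact hinv ▸ mul_inv_cancel₀ hz

theorem isSpectralMeasureOf_spectralMeasure {B : H →ₗ.[ℂ] H} (hB : IsSelfAdjoint B) :
    IsSpectralMeasureOf B (spectralMeasure B) := by
  have hE := exists_isSpectralMeasureOf hB
  rw [spectralMeasure, dif_pos hE]
  exact hE.choose_spec

theorem isUnitaryGroupOf_expI {B : H →ₗ.[ℂ] H} (hB : IsSelfAdjoint B) :
    IsUnitaryGroupOf B (expI B) :=
  ((isSpectralMeasureOf_spectralMeasure hB).isUnitaryGroupOf hB.dense_domain).expI

theorem expI_eq_unitaryGroup {B : H →ₗ.[ℂ] H} (hB : IsSelfAdjoint B) :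
    expI B = (spectralMeasure B).unitaryGroup :=
  (isSpectralMeasureOf_spectralMeasure hB).expI_eq hB

end SpectralTheorem

section BoundedDensity

open scoped FourierTransform SchwartzMap ComplexConjugate

section Plancherel

variable {V K : Type*} [NormedAddCommGroup V] [InnerProductSpace ℝ V] [FiniteDimensional ℝ V]
  [MeasurableSpace V] [BorelSpace V] [NormedAddCommGroup K] [InnerProductSpace ℂ K]

theorem continuous_fourier {f : V → K} (hf : Integrable f) : Continuous (𝓕 f) :=
  VectorFourier.fourierIntegral_continuous Real.continuous_fourierChar
    (by exact continuous_inner) hf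

variable [CompleteSpace K]

theorem fourier_toLp_ae_eq {f : V → K} (hf : Integrable f) (hf2 : MemLp f 2) :
    (𝓕 hf2.toLp : Lp K 2 volume) =ᵐ[volume] 𝓕 f := by
  refine ae_eq_of_integral_contDiff_smul_eq ((Lp.memLp _).locallyIntegrable (by norm_num))
    (continuous_fourier hf).locallyIntegrable fun g hg hc => ?_
  let ψ : 𝓢(V, ℂ) := (hc.comp_left (g := Complex.ofReal) Complex.ofReal_zero).toSchwartzMap
    (Complex.ofRealCLM.contDiff.comp hg)
  have htest : ∀ h : V → K, ∫ x, g x • h x = ∫ x, ψ x • h x := fun h =>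
    integral_congr_ae (ae_of_all _ fun x => (Complex.coe_smul (g x) (h x)).symm)
  have hdistrib := congrArg (fun T : 𝓢'(V, K) => T ψ)
    (Lp.fourier_toTemperedDistribution_eq hf2.toLp)
  simp only [TemperedDistribution.fourier_apply, Lp.toTemperedDistribution_apply] at hdistrib
  rw [htest, htest, ← hdistrib]
  calc ∫ x, 𝓕 ψ x • (hf2.toLp : Lp K 2 volume) x = ∫ x, 𝓕 ψ x • f x := by
        refine integral_congr_ae ?_
        filter_upwards [hf2.coeFn_toLp] with x hx
        rw [hx]
    _ = ∫ x, ψ x • 𝓕 f x := by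
        simpa using! VectorFourier.integral_fourierIntegral_smul_eq_flip (μ := volume)
          (ν := volume) (L := innerₗ V) Real.continuous_fourierChar continuous_inner
          (ψ.integrable (μ := volume)) hf

theorem eLpNorm_two_fourier {f : V → K} (hf : Integrable f) (hf2 : MemLp f 2) :
    eLpNorm (𝓕 f) 2 = eLpNorm f 2 := by
  rw [← eLpNorm_congr_ae (fourier_toLp_ae_eq hf hf2), ← Lp.enorm_def, ← Lp.enorm_toLp hf2,
    ← ofReal_norm, ← ofReal_norm, Lp.norm_fourier_eq]

end Plancherel

theorem integral_mul_character_neg_eq_fourier (f : ℝ → ℂ) (v : ℝ) :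
    ∫ x, f x * character (-v) x = 𝓕 f ((2 * Real.pi)⁻¹ * v) := by
  rw [Real.fourier_real_eq_integral_exp_smul]
  congr 1
  ext x
  rw [smul_eq_mul, mul_comm, character]
  congr 2
  rw [mul_comm Complex.I]
  push_cast
  field_simp

theorem lintegral_enorm_integral_mul_character_neg_sq {f : ℝ → ℂ} (hf : Integrable f)
    (hf2 : MemLp f 2) :
    ∫⁻ v, ‖∫ x, f x * character (-v) x‖ₑ ^ 2 =
      ENNReal.ofReal (2 * Real.pi) * ∫⁻ x, ‖f x‖ₑ ^ 2 := by
  have hmap := lintegral_map (μ := volume) (f := fun v : ℝ => ‖𝓕 f v‖ₑ ^ 2)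
    (g := fun v : ℝ => (2 * Real.pi)⁻¹ * v)
    ((continuous_fourier hf).measurable.enorm.pow_const 2) (by fun_prop)
  simp only [integral_mul_character_neg_eq_fourier]
  rw [← hmap, Real.map_volume_mul_left (by positivity), lintegral_smul_measure, inv_inv,
    abs_of_nonneg (by positivity), smul_eq_mul, ← eLpNorm_two_sq, ← eLpNorm_two_sq,
    eLpNorm_two_fourier hf hf2]

theorem lintegral_enorm_toReal_smul_sq_le {X : Type*} [MeasurableSpace X] {ν : Measure X}
    {ρ : X → ℝ≥0∞} {c : ℝ≥0∞} {f : X → ℂ} (hρ : AEMeasurable ρ ν) (hρc : ∀ᵐ x ∂ν, ρ x ≤ c)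
    (hc : c ≠ ∞) :
    ∫⁻ x, ‖(ρ x).toReal • f x‖ₑ ^ 2 ∂ν ≤ c * ∫⁻ x, ‖f x‖ₑ ^ 2 ∂(ν.withDensity ρ) := by
  have hfin : ∀ᵐ x ∂ν, ρ x < ∞ := hρc.mono fun x hx => hx.trans_lt hc.lt_top
  rw [lintegral_withDensity_eq_lintegral_mul_non_measurable₀ ν hρ hfin,
    ← lintegral_const_mul' _ _ hc]
  refine lintegral_mono_ae ?_
  filter_upwards [hρc, hfin] with x hx hx'
  rw [enorm_smul, Real.enorm_of_nonneg ENNReal.toReal_nonneg, ENNReal.ofReal_toReal hx'.ne,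
    mul_pow, sq (ρ x), mul_assoc, Pi.mul_apply]
  gcongr

theorem lintegral_enorm_integral_withDensity_mul_character_neg_sq_le {ρ : ℝ → ℝ≥0∞} {c : ℝ≥0∞}
    {f : ℝ → ℂ} (hρ : AEMeasurable ρ) (hρc : ∀ᵐ x, ρ x ≤ c) (hc : c ≠ ∞)
    [IsFiniteMeasure (volume.withDensity ρ)] (hf : MemLp f 2 (volume.withDensity ρ)) :
    ∫⁻ v, ‖∫ x, f x * character (-v) x ∂(volume.withDensity ρ)‖ₑ ^ 2 ≤
      ENNReal.ofReal (2 * Real.pi) * (c * ∫⁻ x, ‖f x‖ₑ ^ 2 ∂(volume.withDensity ρ)) := by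
  have hfin : ∀ᵐ x, ρ x < ∞ := hρc.mono fun x hx => hx.trans_lt hc.lt_top
  have hint : Integrable fun x => (ρ x).toReal • f x :=
    (integrable_withDensity_iff_integrable_smul₀' hρ hfin).1 (hf.integrable one_le_two)
  have hsq := lintegral_enorm_toReal_smul_sq_le (f := f) hρ hρc hc
  have hmem : MemLp (fun x => (ρ x).toReal • f x) 2 := by
    refine ⟨hint.1, (ENNReal.pow_lt_top_iff.1 ?_).resolve_right two_ne_zero⟩
    rw [eLpNorm_two_sq]
    refine hsq.trans_lt ?_
    rw [← eLpNorm_two_sq]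
    exact ENNReal.mul_lt_top hc.lt_top (ENNReal.pow_lt_top hf.2)
  simp only [integral_withDensity_eq_integral_toReal_smul₀ hρ hfin, ← smul_mul_assoc]
  rw [lintegral_enorm_integral_mul_character_neg_sq hint hmem]
  gcongr

variable {H : Type*} [NormedAddCommGroup H] [InnerProductSpace ℂ H] [CompleteSpace H]

-- The representing vector is the orthogonal projection of `η` to the cyclic subspace of `φ`.
theorem L2Calculus.exists_represents_inner_eq {X D : Type*} [MeasurableSpace X] [AddCommGroup D]
    [Module ℂ D] (F : L2Calculus H X D) (φ η : H) :
    ∃ f ψ, F.Represents φ f ψ ∧ ‖ψ‖ ≤ ‖η‖ ∧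
      ∀ g χ, F.Represents φ g χ → ⟪η, χ⟫_ℂ = ⟪ψ, χ⟫_ℂ := by
  let W := (F.vector φ).toContinuousLinearMap
  let f := ContinuousLinearMap.adjoint W η
  have hrep := F.represents_vector φ (Lp.memLp f)
  rw [Lp.toLp_coeFn] at hrep
  refine ⟨f, F.vector φ f, hrep, ?_, ?_⟩
  · rw [LinearIsometry.norm_map]
    refine ((ContinuousLinearMap.adjoint W).le_opNorm η).trans ?_
    rw [LinearIsometryEquiv.norm_map]
    exact mul_le_of_le_one_left (norm_nonneg _) (F.vector φ).norm_toContinuousLinearMap_le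
  · rintro g _ ⟨hg, rfl⟩
    rw [LinearIsometry.inner_map_map, ContinuousLinearMap.adjoint_inner_left]
    rfl

theorem ProjMeasure.lintegral_inner_unitaryGroup_sq_le (E : ProjMeasure H) {φ : H} {f : ℝ → ℂ}
    (hf : AEStronglyMeasurable f volume) (hf' : eLpNorm f ∞ volume ≠ ∞)
    (hφ : E.scalar φ = volume.withDensity fun x => ‖f x‖ₑ ^ 2) (η : H) :
    ∫⁻ v, ‖⟪η, E.unitaryGroup (-v) φ⟫_ℂ‖ₑ ^ 2 ≤
      ENNReal.ofReal (2 * Real.pi) * (eLpNorm f ∞ volume ^ 2 * ‖η‖ₑ ^ 2) := by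
  obtain ⟨g, ψ, hg, hψ, hinner⟩ := E.calculus.exists_represents_inner_eq φ η
  have htransform : ∀ v, ⟪η, E.unitaryGroup (-v) φ⟫_ℂ =
      ∫ x, conj (g x) * character (-v) x ∂E.scalar φ := fun v => by
    rw [hinner _ _ (E.represents_unitaryGroup (-v) φ)]
    exact hg.inner_eq (E.represents_unitaryGroup (-v) φ)
  have hbound : ∀ᵐ x, ‖f x‖ₑ ^ 2 ≤ eLpNorm f ∞ volume ^ 2 := by
    rw [eLpNorm_exponent_top]
    filter_upwards [enorm_ae_le_eLpNormEssSup f volume] with x hx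
    gcongr
  have hmem : MemLp (fun x => conj (g x)) 2 (E.scalar φ) := hg.memLp.star
  have hfinite : IsFiniteMeasure (E.scalar φ) := inferInstance
  have hnorm : ∫⁻ x, ‖conj (g x)‖ₑ ^ 2 ∂E.scalar φ ≤ ‖η‖ₑ ^ 2 := by
    simp only [RCLike.enorm_conj]
    rw [← eLpNorm_two_sq]
    refine (congrArg (· ^ 2) hg.enorm_eq).symm.trans_le ?_
    gcongr
    exact enorm_le_iff_norm_le.2 hψ
  simp only [htransform]
  rw [hφ] at hmem hfinite hnorm ⊢
  refine (lintegral_enorm_integral_withDensity_mul_character_neg_sq_le (hf.enorm.pow_const 2)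
    hbound (by finiteness) hmem).trans ?_
  gcongr

theorem exists_lintegral_inner_expI_sq_le {B : H →ₗ.[ℂ] H} (hB : IsSelfAdjoint B) {φ : H}
    (hφ : φ ∈ boundedDensitySet B) :
    ∃ c : NNReal, ∀ η, ∫⁻ v, ‖⟪η, expI B (-v) φ⟫_ℂ‖ₑ ^ 2 ≤ c * ‖η‖ₑ ^ 2 := by
  obtain ⟨f, ⟨hf, hf'⟩, hscalar⟩ := hφ
  refine ⟨(ENNReal.ofReal (2 * Real.pi) * eLpNorm f ∞ volume ^ 2).toNNReal, fun η => ?_⟩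
  rw [ENNReal.coe_toNNReal (by finiteness), mul_assoc, expI_eq_unitaryGroup hB]
  exact ProjMeasure.lintegral_inner_unitaryGroup_sq_le _ hf hf'.ne hscalar η

end BoundedDensity

section TraceClass

variable {H : Type*} [NormedAddCommGroup H] [InnerProductSpace ℂ H] [CompleteSpace H]

theorem norm_abs_apply (T : H →L[ℂ] H) (y : H) : ‖CFC.abs T y‖ = ‖T y‖ := by
  have hsa : ContinuousLinearMap.adjoint (CFC.abs T) = CFC.abs T :=
    (CFC.abs_nonneg T).isSelfAdjoint
  have hinner : ⟪CFC.abs T y, CFC.abs T y⟫_ℂ = ⟪T y, T y⟫_ℂ := by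
    rw [← ContinuousLinearMap.adjoint_inner_right, hsa, ← mul_apply_eq_comp, CFC.abs_mul_abs,
      mul_apply_eq_comp, ContinuousLinearMap.star_eq_adjoint,
      ContinuousLinearMap.adjoint_inner_right]
  rw [@norm_eq_sqrt_re_inner ℂ, @norm_eq_sqrt_re_inner ℂ, hinner]

theorem exists_comp_eq_of_norm_le {E F : Type*} [NormedAddCommGroup E] [NormedSpace ℂ E]
    [NormedAddCommGroup F] [NormedSpace ℂ F] [CompleteSpace F] {T : E →L[ℂ] F} {D : E →L[ℂ] H}
    {c : ℝ} (h : ∀ y, ‖T y‖ ≤ c * ‖D y‖) :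
    ∃ G : H →L[ℂ] F, G ∘L D = T ∧ ∀ z ∈ D.rangeᗮ, G z = 0 := by
  set K := D.range.topologicalClosure with hK
  have : CompleteSpace K := (Submodule.isClosed_topologicalClosure _).completeSpace_coe
  let e : E →ₗ[ℂ] K := (D : E →ₗ[ℂ] H).codRestrict K fun y =>
    Submodule.le_topologicalClosure _ ⟨y, rfl⟩
  have hdense : DenseRange e := by
    rintro ⟨k, hk⟩
    rw [closure_subtype, ← range_comp]
    exact hk
  refine ⟨((T : E →ₗ[ℂ] F).extendOfNorm e) ∘L K.orthogonalProjectionOnto, ?_, fun z hz => ?_⟩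
  · ext y
    have hproj : K.orthogonalProjectionOnto (D y) = e y :=
      Submodule.orthogonalProjectionOnto_mem_subspace_eq_self (e y)
    rw [ContinuousLinearMap.comp_apply, ContinuousLinearMap.comp_apply, hproj]
    exact LinearMap.extendOfNorm_eq hdense ⟨c, h⟩ y
  · rw [← Submodule.orthogonal_closure, ← hK] at hz
    rw [ContinuousLinearMap.comp_apply,
      Submodule.orthogonalProjectionOnto_eq_zero_iff.2 hz, _root_.map_zero]

theorem exists_eq_mul_of_norm_apply_eq {T D : H →L[ℂ] H} (hD : ContinuousLinearMap.adjoint D = D)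
    (hT : ∀ y, ‖T y‖ = ‖D (D y)‖) : ∃ G : H →L[ℂ] H, T = G * D ∧ ∀ z, ‖G z‖ = ‖D z‖ := by
  obtain ⟨G, hGD, hG⟩ := exists_comp_eq_of_norm_le (T := T) (D := D) (c := ‖D‖) fun y => by
    rw [hT]
    exact D.le_opNorm _
  refine ⟨G, hGD.symm, fun z => ?_⟩
  have hrange : ∀ k ∈ D.range.topologicalClosure, ‖G k‖ = ‖D k‖ := by
    refine fun k hk => closure_minimal ?_
      (isClosed_eq (f := fun k => ‖G k‖) (g := fun k => ‖D k‖) (by fun_prop) (by fun_prop)) hk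
    rintro _ ⟨y, rfl⟩
    change ‖(G ∘L D) y‖ = ‖D (D y)‖
    rw [hGD, hT]
  have : CompleteSpace D.range.topologicalClosure :=
    (Submodule.isClosed_topologicalClosure _).completeSpace_coe
  obtain ⟨k, hk, z', hz', rfl⟩ := D.range.topologicalClosure.exists_add_mem_mem_orthogonal z
  rw [Submodule.orthogonal_closure] at hz'
  have hDz' : D z' = 0 := by
    rw [D.orthogonal_range, hD] at hz'
    exact hz'
  rw [_root_.map_add, _root_.map_add, hG z' hz', hDz', add_zero, add_zero, hrange k hk]

-- `D` is `|T|^(1/2)`, which is Hilbert-Schmidt, and `G = U D` for the polar decomposition `U |T|`.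
theorem IsTraceClass.exists_eq_mul {T : H →L[ℂ] H} (hT : IsTraceClass T) :
    ∃ (G D : H →L[ℂ] H) (w : Set H) (b : HilbertBasis w ℂ H), T = G * D ∧
      ContinuousLinearMap.adjoint D = D ∧
      ∑' i, ‖D (b i)‖ₑ ^ 2 ≠ ∞ ∧ ∑' i, ‖G (b i)‖ₑ ^ 2 ≠ ∞ := by
  obtain ⟨w, b, hb⟩ := hT
  let D := CFC.sqrt (CFC.abs T)
  have hD : ContinuousLinearMap.adjoint D = D := (CFC.sqrt_nonneg (CFC.abs T)).isSelfAdjoint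
  have hDD : D * D = CFC.abs T := CFC.sqrt_mul_sqrt_self _ (CFC.abs_nonneg T)
  obtain ⟨G, hG, hnorm⟩ := exists_eq_mul_of_norm_apply_eq (T := T) hD fun y => by
    rw [← mul_apply_eq_comp, hDD, norm_abs_apply]
  have henorm : ∀ z, ‖G z‖ₑ = ‖D z‖ₑ := fun z => enorm_eq_iff_norm_eq.2 (hnorm z)
  have hsq : ∀ i, ‖D (b i)‖ₑ ^ 2 = ENNReal.ofReal (⟪b i, CFC.abs T (b i)⟫_ℂ).re := fun i => by
    rw [← hDD, mul_apply_eq_comp, ← ContinuousLinearMap.adjoint_inner_left, hD,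
      inner_self_eq_norm_sq_to_K, ← ofReal_norm, ← ENNReal.ofReal_pow (norm_nonneg _)]
    norm_cast
  refine ⟨G, D, w, b, hG, hD, ?_, ?_⟩
  all_goals
    simp only [henorm, hsq]
    exact hb.tsum_ofReal_ne_top

theorem enorm_adjoint_sq_eq_tsum {ι : Type*} (b : HilbertBasis ι ℂ H) (S : H →L[ℂ] H) (x : H) :
    ‖ContinuousLinearMap.adjoint S x‖ₑ ^ 2 = ∑' i, ‖⟪S (b i), x⟫_ℂ‖ₑ ^ 2 := by
  have hparseval : HasSum (fun i => ‖⟪S (b i), x⟫_ℂ‖ ^ 2)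
      (‖ContinuousLinearMap.adjoint S x‖ ^ 2) := by
    simp only [← ContinuousLinearMap.adjoint_inner_right]
    convert (b.hasSum_inner_mul_inner (ContinuousLinearMap.adjoint S x)
      (ContinuousLinearMap.adjoint S x)).mapL Complex.reCLM using 1
    · ext i
      rw [← inner_conj_symm (ContinuousLinearMap.adjoint S x) (b i), Complex.conj_mul']
      simp [← Complex.ofReal_pow]
    · rw [inner_self_eq_norm_sq_to_K]
      simp [← Complex.ofReal_pow]
  simp only [← ofReal_norm, ← ENNReal.ofReal_pow (norm_nonneg _)]
  rw [← hparseval.tsum_eq,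
    ENNReal.ofReal_tsum_of_nonneg (fun i => by positivity) hparseval.summable]

variable {X : Type*} [MeasurableSpace X] {ν : Measure X} {u : X → H} {c : ℝ≥0∞}

theorem lintegral_inner_apply_sq_le (hc : ∀ η, ∫⁻ v, ‖⟪η, u v⟫_ℂ‖ₑ ^ 2 ∂ν ≤ c * ‖η‖ₑ ^ 2)
    (K : H →L[ℂ] H) (η : H) :
    ∫⁻ v, ‖⟪η, K (u v)⟫_ℂ‖ₑ ^ 2 ∂ν ≤ c * ‖K‖ₑ ^ 2 * ‖η‖ₑ ^ 2 := by
  have hadjoint : ‖ContinuousLinearMap.adjoint K‖ₑ = ‖K‖ₑ :=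
    enorm_eq_iff_norm_eq.2 (LinearIsometryEquiv.norm_map _ _)
  simp only [← ContinuousLinearMap.adjoint_inner_left K]
  refine (hc _).trans ?_
  rw [mul_assoc, ← mul_pow, ← hadjoint]
  gcongr
  exact ContinuousLinearMap.le_opENorm _ _

theorem lintegral_enorm_adjoint_sq_le {ι : Type*} (b : HilbertBasis ι ℂ H) {S : H →L[ℂ] H}
    (hS : ∑' i, ‖S (b i)‖ₑ ^ 2 ≠ ∞) (hu : AEStronglyMeasurable u ν)
    (hc : ∀ η, ∫⁻ v, ‖⟪η, u v⟫_ℂ‖ₑ ^ 2 ∂ν ≤ c * ‖η‖ₑ ^ 2) :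
    ∫⁻ v, ‖ContinuousLinearMap.adjoint S (u v)‖ₑ ^ 2 ∂ν ≤ c * ∑' i, ‖S (b i)‖ₑ ^ 2 := by
  -- `lintegral_tsum` needs a countable index type, so we drop the indices with `S (b i) = 0`.
  let s : Set ι := Function.support fun i => ‖S (b i)‖ₑ ^ 2
  have hcount : Countable s := (Summable.countable_support_ennreal hS).to_subtype
  have hzero : ∀ i ∉ s, S (b i) = 0 := fun i hi => by simpa [s] using hi
  have hsum : ∀ x, ‖ContinuousLinearMap.adjoint S x‖ₑ ^ 2 =
      ∑' i : s, ‖⟪S (b i), x⟫_ℂ‖ₑ ^ 2 := by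
    intro x
    rw [enorm_adjoint_sq_eq_tsum b S x]
    refine (tsum_subtype_eq_of_support_subset (f := fun i => ‖⟪S (b i), x⟫_ℂ‖ₑ ^ 2)
      fun i hi => ?_).symm
    by_contra h
    exact hi (by simp [hzero i h])
  simp only [hsum]
  rw [lintegral_tsum fun i => hu.const_inner.enorm.pow_const 2]
  calc ∑' i : s, ∫⁻ v, ‖⟪S (b i), u v⟫_ℂ‖ₑ ^ 2 ∂ν
      ≤ ∑' i : s, c * ‖S (b i)‖ₑ ^ 2 := ENNReal.tsum_le_tsum fun i => hc _
    _ = c * ∑' i : s, ‖S (b i)‖ₑ ^ 2 := ENNReal.tsum_mul_left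
    _ ≤ c * ∑' i, ‖S (b i)‖ₑ ^ 2 := by
      gcongr
      exact ENNReal.tsum_comp_le_tsum_of_injective Subtype.val_injective _

end TraceClass

section Convergence

theorem setLIntegral_Ioi_comp_add_left (f : ℝ → ℝ≥0∞) (a b : ℝ) :
    ∫⁻ x in Ioi a, f (b + x) = ∫⁻ x in Ioi (b + a), f x := by
  have hpre : (b + ·) ⁻¹' Ioi (b + a) = Ioi a := by simp
  rw [← hpre]
  exact (measurePreserving_add_left volume b).setLIntegral_comp_preimage_emb
    (measurableEmbedding_addLeft b) f _

theorem tendsto_setLIntegral_Ioi_atTop {ν : Measure ℝ} {f : ℝ → ℝ≥0∞} {a : ℝ}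
    (hf : ∫⁻ x in Ioi a, f x ∂ν ≠ ∞) :
    Tendsto (fun s => ∫⁻ x in Ioi s, f x ∂ν) atTop (𝓝 0) := by
  have h := tendsto_measure_iInter_atTop (μ := ν.withDensity f)
    (fun s : ℝ => measurableSet_Ioi.nullMeasurableSet) (fun _ _ hst => Ioi_subset_Ioi hst)
    ⟨a, by rwa [withDensity_apply _ measurableSet_Ioi]⟩
  rw [iInter_eq_empty_iff.2 fun x => ⟨x, self_notMem_Ioi⟩, measure_empty] at h
  exact h.congr fun s => withDensity_apply _ measurableSet_Ioi

theorem lintegral_mul_le_sqrt_mul_sqrt {X : Type*} [MeasurableSpace X] {ν : Measure X}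
    {f g : X → ℝ≥0∞} (hf : AEMeasurable f ν) (hg : AEMeasurable g ν) :
    ∫⁻ x, f x * g x ∂ν ≤ (∫⁻ x, f x ^ 2 ∂ν) ^ (1 / 2 : ℝ) * (∫⁻ x, g x ^ 2 ∂ν) ^ (1 / 2 : ℝ) := by
  simpa only [Pi.mul_apply, ENNReal.rpow_two] using
    ENNReal.lintegral_mul_le_Lp_mul_Lq ν Real.HolderConjugate.two_two hf hg

variable {H : Type*} [NormedAddCommGroup H] [InnerProductSpace ℂ H] {w w' : ℝ → H}

theorem enorm_sq_le_lintegral_inner_of_tendsto_zero (hw : ∀ t, HasDerivAt w (w' t) t)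
    (hw' : Continuous w') (hlim : Tendsto w atTop (𝓝 0)) (s : ℝ) :
    ‖w s‖ₑ ^ 2 ≤ 2 * ∫⁻ t in Ioi s, ‖⟪w t, w' t⟫_ℂ‖ₑ := by
  by_cases hfin : ∫⁻ t in Ioi s, ‖⟪w t, w' t⟫_ℂ‖ₑ = ∞
  · simp [hfin]
  have hcont : Continuous fun t => ⟪w t, w' t⟫_ℂ :=
    (continuous_iff_continuousAt.2 fun t => (hw t).continuousAt).inner hw'
  have hint : IntegrableOn (fun t => ⟪w t, w' t⟫_ℂ) (Ioi s) :=
    ⟨hcont.aestronglyMeasurable, lt_top_iff_ne_top.2 hfin⟩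
  have hderiv : ∀ t, HasDerivAt (fun t => ‖w t‖ ^ 2) (2 * (⟪w t, w' t⟫_ℂ).re) t := fun t => by
    let _ : InnerProductSpace ℝ H := InnerProductSpace.rclikeToReal ℂ H
    exact (hw t).norm_sq
  have hFTC := integral_Ioi_of_hasDerivAt_of_tendsto' (fun t (_ : t ∈ Ici s) => hderiv t)
    (hint.re.const_mul 2) (hlim.norm.pow 2)
  rw [norm_zero, zero_pow two_ne_zero, zero_sub, integral_const_mul] at hFTC
  have hre : ∫ t in Ioi s, (⟪w t, w' t⟫_ℂ).re = (∫ t in Ioi s, ⟪w t, w' t⟫_ℂ).re :=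
    integral_re hint
  calc ‖w s‖ₑ ^ 2 = ‖2 * (∫ t in Ioi s, ⟪w t, w' t⟫_ℂ).re‖ₑ := by
        rw [← hre, hFTC, enorm_neg, enorm_pow, enorm_norm]
    _ ≤ 2 * ‖∫ t in Ioi s, ⟪w t, w' t⟫_ℂ‖ₑ := by
        rw [enorm_mul, Real.enorm_of_nonneg zero_le_two, ENNReal.ofReal_ofNat]
        gcongr
        exact enorm_le_iff_norm_le.2 (Complex.abs_re_le_norm _)
    _ ≤ 2 * ∫⁻ t in Ioi s, ‖⟪w t, w' t⟫_ℂ‖ₑ := by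
        gcongr
        exact enorm_integral_le_lintegral_enorm _

theorem enorm_inner_le_enorm_mul_enorm (x y : H) : ‖⟪x, y⟫_ℂ‖ₑ ≤ ‖x‖ₑ * ‖y‖ₑ := by
  simp only [enorm_eq_nnnorm]
  exact_mod_cast nnnorm_inner_le_nnnorm (𝕜 := ℂ) x y

theorem enorm_inner_sub_sub_le (x x' y y' : H) :
    ‖⟪x - x', y - y'⟫_ℂ‖ₑ ≤
      ‖⟪x, y⟫_ℂ‖ₑ + ‖⟪x, y'⟫_ℂ‖ₑ + (‖⟪x', y⟫_ℂ‖ₑ + ‖⟪x', y'⟫_ℂ‖ₑ) := by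
  rw [inner_sub_left, inner_sub_right, inner_sub_right]
  exact enorm_sub_le.trans (add_le_add enorm_sub_le enorm_sub_le)

variable [CompleteSpace H]

theorem exists_tendsto_of_lintegral_inner_le (hw : ∀ t, HasDerivAt w (w' t) t)
    (hw' : Continuous w') (hlim : ∀ d, Tendsto (fun t => w (d + t) - w t) atTop (𝓝 0))
    {β : ℝ → ℝ≥0∞} (hβ : Tendsto β atTop (𝓝 0))
    (h : ∀ s, ∀ x ≥ s, ∀ y ≥ s, ∫⁻ a in Ioi 0, ‖⟪w (x + a), w' (y + a)⟫_ℂ‖ₑ ≤ β s) :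
    ∃ z, Tendsto w atTop (𝓝 z) := by
  have hsq : ∀ s, ∀ x ≥ s, ∀ y ≥ s, ‖w x - w y‖ₑ ^ 2 ≤ 8 * β s := by
    intro s x hx y hy
    have hshift : Tendsto (fun a => w (x + a) - w (y + a)) atTop (𝓝 0) :=
      ((hlim (x - y)).comp (tendsto_atTop_add_const_left _ y tendsto_id)).congr fun a => by
        simp only [Function.comp, id, ← add_assoc, sub_add_cancel]
    have hcont : Continuous w := continuous_iff_continuousAt.2 fun t => (hw t).continuousAt
    have hmeas : ∀ x y : ℝ, Measurable fun a : ℝ => ‖⟪w (x + a), w' (y + a)⟫_ℂ‖ₑ := fun x y =>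
      Continuous.measurable (by fun_prop)
    calc ‖w x - w y‖ₑ ^ 2
        ≤ 2 * ∫⁻ a in Ioi 0, ‖⟪w (x + a) - w (y + a), w' (x + a) - w' (y + a)⟫_ℂ‖ₑ := by
          simpa using! enorm_sq_le_lintegral_inner_of_tendsto_zero
            (fun a => ((hw (x + a)).comp_const_add x a).sub ((hw (y + a)).comp_const_add y a))
            (by fun_prop) hshift 0
      _ ≤ 2 * (β s + β s + (β s + β s)) := by
          gcongr
          refine (lintegral_mono fun a => enorm_inner_sub_sub_le _ _ _ _).trans ?_
          rw [lintegral_add_left ((hmeas x x).fun_add (hmeas x y)),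
            lintegral_add_left (hmeas x x), lintegral_add_left (hmeas y x)]
          exact add_le_add (add_le_add (h s x hx x hx) (h s x hx y hy))
            (add_le_add (h s y hy x hx) (h s y hy y hy))
      _ = 8 * β s := by ring
  refine cauchySeq_tendsto_of_complete (EMetric.cauchySeq_iff_le_tendsto_0.2
    ⟨fun s => (8 * β s) ^ (2⁻¹ : ℝ), fun x y s hx hy => ?_, ?_⟩)
  · rw [edist_eq_enorm_sub, ENNReal.le_rpow_inv_iff two_pos, ENNReal.rpow_two]
    exact hsq s x hx y hy
  · have h8 : Tendsto (fun s => 8 * β s) atTop (𝓝 0) := by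
      simpa using ENNReal.Tendsto.const_mul hβ (Or.inr (by simp : (8 : ℝ≥0∞) ≠ ∞))
    simpa using h8.ennrpow_const 2⁻¹

theorem tendsto_sub_of_enorm_deriv_le (hw : ∀ t, HasDerivAt w (w' t) t) (hw' : Continuous w')
    {p q : ℝ → ℝ≥0∞} {a : ℝ} (hp : Measurable p) (hbound : ∀ t, ‖w' t‖ₑ ≤ p t + q t)
    (hp2 : ∫⁻ t in Ioi a, p t ^ 2 ≠ ∞) (hq : ∫⁻ t in Ioi a, q t ≠ ∞) (d : ℝ) :
    Tendsto (fun t => w (d + t) - w t) atTop (𝓝 0) := by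
  have hle : ∀ t, ‖w (d + t) - w t‖ₑ ≤
      ENNReal.ofReal |d| ^ (1 / 2 : ℝ) * (∫⁻ x in Ioi (min t (d + t)), p x ^ 2) ^ (1 / 2 : ℝ) +
        ∫⁻ x in Ioi (min t (d + t)), q x := by
    intro t
    have hsub : uIoc t (d + t) ⊆ Ioi (min t (d + t)) := fun x hx => hx.1
    have hvol : volume (uIoc t (d + t)) = ENNReal.ofReal |d| := by
      rw [Real.volume_uIoc, add_sub_cancel_right]
    rw [← intervalIntegral.integral_eq_sub_of_hasDerivAt (fun x _ => hw x)
      (hw'.intervalIntegrable t (d + t)),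
      enorm_eq_iff_norm_eq.2 (intervalIntegral.norm_integral_eq_norm_integral_uIoc w')]
    refine (enorm_integral_le_lintegral_enorm _).trans ?_
    calc ∫⁻ x in uIoc t (d + t), ‖w' x‖ₑ ≤ ∫⁻ x in uIoc t (d + t), (1 * p x + q x) :=
          lintegral_mono fun x => by simpa only [one_mul] using hbound x
      _ = (∫⁻ x in uIoc t (d + t), 1 * p x) + ∫⁻ x in uIoc t (d + t), q x :=
          lintegral_add_left (hp.const_mul 1) q
      _ ≤ _ := by
          refine add_le_add ((lintegral_mul_le_sqrt_mul_sqrt aemeasurable_const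
            hp.aemeasurable).trans ?_) (lintegral_mono_set hsub)
          rw [one_pow, lintegral_one, Measure.restrict_apply_univ, hvol]
          gcongr
  have hmin : Tendsto (fun t => min t (d + t)) atTop atTop :=
    tendsto_inf_atTop _ tendsto_id (tendsto_atTop_add_const_left _ d tendsto_id)
  have hzero := (ENNReal.Tendsto.const_mul
    (((tendsto_setLIntegral_Ioi_atTop hp2).comp hmin).ennrpow_const (1 / 2))
    (Or.inr (by finiteness : ENNReal.ofReal |d| ^ (1 / 2 : ℝ) ≠ ∞))).add
      ((tendsto_setLIntegral_Ioi_atTop hq).comp hmin)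
  rw [tendsto_zero_iff_enorm_tendsto_zero]
  refine tendsto_of_tendsto_of_tendsto_of_le_of_le tendsto_const_nhds ?_
    (fun t => zero_le) hle
  simpa using hzero

theorem hasDerivAt_of_forall_inner {S : Set H} (hS : Dense S) (hw' : Continuous w')
    (h : ∀ x ∈ S, ∀ t, HasDerivAt (fun t => ⟪x, w t⟫_ℂ) ⟪x, w' t⟫_ℂ t) (t : ℝ) :
    HasDerivAt w (w' t) t := by
  have hint : ∀ s, w 0 + ∫ r in (0 : ℝ)..s, w' r = w s := by
    intro s
    rw [← eq_sub_iff_add_eq']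
    refine hS.eq_of_inner_right (𝕜 := ℂ) fun x hx => ?_
    rw [inner_sub_right, ← intervalIntegral.integral_eq_sub_of_hasDerivAt (fun r _ => h x hx r)
      ((continuous_const.inner hw').intervalIntegrable 0 s)]
    exact ((innerSL ℂ x).intervalIntegral_comp_comm (hw'.intervalIntegrable 0 s)).symm
  rw [← funext hint]
  exact (hw'.integral_hasStrictDerivAt 0 t).hasDerivAt.const_add (w 0)

end Convergence

section Wave

variable {H : Type*} [NormedAddCommGroup H] [InnerProductSpace ℂ H] [CompleteSpace H]

namespace IsUnitaryGroupOf

variable {A : H →ₗ.[ℂ] H} {U : ℝ → H →L[ℂ] H}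

theorem continuous_apply (hU : IsUnitaryGroupOf A U) {u : ℝ → H} (hu : Continuous u) :
    Continuous fun t => U t (u t) := by
  have hjoint : Continuous fun p : ℝ × H => U p.1 p.2 :=
    continuous_prod_of_continuous_lipschitzWith' _ 1
      (fun t => (AddMonoidHomClass.isometry_of_norm (U t) (hU.norm_apply t)).lipschitz)
      hU.continuous
  exact hjoint.comp (continuous_id.prodMk hu)

theorem hasDerivAt_neg (hU : IsUnitaryGroupOf A U) (φ : A.domain) (t : ℝ) :
    HasDerivAt (fun t => U (-t) φ) (-(Complex.I • U (-t) (A φ))) t := by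
  simpa [Function.comp_def] using (hU.hasDerivAt φ (-t)).scomp t (_root_.hasDerivAt_neg t)

end IsUnitaryGroupOf

/-- The operators `e^{itA} J e^{-itB}`, whose strong limit as `t → ∞` is the wave operator. -/
def wave (A B : H →ₗ.[ℂ] H) (J : H →L[ℂ] H) (t : ℝ) : H →L[ℂ] H := expI A t * J * expI B (-t)

variable {A B : H →ₗ.[ℂ] H} {J C G D C₂ : H →L[ℂ] H}

theorem wave_apply (t : ℝ) (φ : H) : wave A B J t φ = expI A t (J (expI B (-t) φ)) := rfl

theorem norm_wave_apply (hA : IsSelfAdjoint A) (t : ℝ) (φ : H) :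
    ‖wave A B J t φ‖ = ‖J (expI B (-t) φ)‖ := by
  rw [wave_apply, (isUnitaryGroupOf_expI hA).norm_apply]

theorem norm_wave_apply_le (hA : IsSelfAdjoint A) (hB : IsSelfAdjoint B) (t : ℝ) (φ : H) :
    ‖wave A B J t φ‖ ≤ ‖J‖ * ‖φ‖ := by
  rw [norm_wave_apply hA, ← (isUnitaryGroupOf_expI hB).norm_apply (-t) φ]
  exact J.le_opNorm _

theorem continuous_expI_neg (hB : IsSelfAdjoint B) (φ : H) : Continuous fun t => expI B (-t) φ :=
  ((isUnitaryGroupOf_expI hB).continuous φ).comp continuous_neg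

theorem continuous_wave (hA : IsSelfAdjoint A) (hB : IsSelfAdjoint B) (φ : H) :
    Continuous fun t => wave A B J t φ :=
  (isUnitaryGroupOf_expI hA).continuous_apply (J.continuous.comp (continuous_expI_neg hB φ))

theorem hasDerivAt_inner_wave (hA : IsSelfAdjoint A) (hB : IsSelfAdjoint B)
    (hC : ∀ (φ : A.domain) (ψ : B.domain),
      ⟪(φ : H), C (ψ : H)⟫_ℂ = ⟪A φ, J (ψ : H)⟫_ℂ - ⟪(φ : H), J (B ψ)⟫_ℂ)
    (x : A.domain) (y : B.domain) (t : ℝ) :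
    HasDerivAt (fun t => ⟪(x : H), wave A B J t y⟫_ℂ)
      ⟪(x : H), Complex.I • wave A B C t y⟫_ℂ t := by
  have hU := isUnitaryGroupOf_expI hA
  have hV := isUnitaryGroupOf_expI hB
  have hmove : ∀ t z, ⟪(x : H), expI A t z⟫_ℂ = ⟪expI A (-t) x, z⟫_ℂ := fun t z => by
    rw [hU.inner_apply_left, neg_neg]
  simp only [wave_apply, hmove, inner_smul_right]
  refine ((hU.hasDerivAt_neg x t).inner ℂ ((J.restrictScalars ℝ).hasFDerivAt.comp_hasDerivAt t
    (hV.hasDerivAt_neg y t))).congr_deriv ?_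
  obtain ⟨u, hu, hAu⟩ := (LinearPMap.mem_graph_iff _).1 (hU.apply_mem_graph x (-t))
  obtain ⟨v, hv, hBv⟩ := (LinearPMap.mem_graph_iff _).1 (hV.apply_mem_graph y (-t))
  dsimp only at hu hAu hv hBv
  simp only [Function.comp, ContinuousLinearMap.coe_restrictScalars', map_neg, map_smul,
    inner_neg_right, inner_neg_left, inner_smul_right, inner_smul_left, Complex.conj_I]
  rw [← hAu, ← hBv, ← hu, ← hv, hC u v]
  ring

theorem hasDerivAt_wave (hA : IsSelfAdjoint A) (hB : IsSelfAdjoint B)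
    (hC : ∀ (φ : A.domain) (ψ : B.domain),
      ⟪(φ : H), C (ψ : H)⟫_ℂ = ⟪A φ, J (ψ : H)⟫_ℂ - ⟪(φ : H), J (B ψ)⟫_ℂ)
    (φ : H) (t : ℝ) :
    HasDerivAt (fun t => wave A B J t φ) (Complex.I • wave A B C t φ) t := by
  have hdom : ∀ y ∈ B.domain, ∀ t,
      HasDerivAt (fun t => wave A B J t y) (Complex.I • wave A B C t y) t := fun y hy =>
    hasDerivAt_of_forall_inner hA.dense_domain ((continuous_wave hA hB y).const_smul _)
      fun x hx => hasDerivAt_inner_wave hA hB hC ⟨x, hx⟩ ⟨y, hy⟩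
  have hne : (𝓝[(B.domain : Set H)] φ).NeBot := mem_closure_iff_nhdsWithin_neBot.1
    (hB.dense_domain φ)
  refine hasDerivAt_of_tendstoUniformly (l := 𝓝[(B.domain : Set H)] φ)
    (f := fun y t => wave A B J t y) (f' := fun y t => Complex.I • wave A B C t y)
    (g' := fun t => Complex.I • wave A B C t φ) ?_
    (eventually_nhdsWithin_of_forall hdom)
    (fun s => ((wave A B J s).continuous.tendsto φ).mono_left nhdsWithin_le_nhds) t
  have hzero : Tendsto (fun y => ‖C‖ * ‖φ - y‖) (𝓝[(B.domain : Set H)] φ) (𝓝 0) := by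
    have hcont : Continuous fun y => ‖C‖ * ‖φ - y‖ := by fun_prop
    simpa using (hcont.tendsto φ).mono_left nhdsWithin_le_nhds
  refine Metric.tendstoUniformly_iff.2 fun ε hε => ?_
  filter_upwards [hzero.eventually_lt_const hε] with y hy s
  rw [dist_eq_norm, ← smul_sub, ← map_sub, norm_smul, Complex.norm_I, one_mul]
  exact (norm_wave_apply_le hA hB s _).trans_lt hy

theorem enorm_wave_apply_le (hA : IsSelfAdjoint A) (t : ℝ) (φ : H) :
    ‖wave A B (G * D + C₂) t φ‖ₑ ≤
      ‖G‖ₑ * ‖D (expI B (-t) φ)‖ₑ + ‖C₂ (expI B (-t) φ)‖ₑ := by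
  rw [enorm_eq_iff_norm_eq.2 (norm_wave_apply hA t φ), add_apply, mul_apply_eq_comp]
  exact (enorm_add_le _ _).trans (add_le_add (G.le_opENorm _) le_rfl)

theorem enorm_inner_wave_le (hA : IsSelfAdjoint A) (hB : IsSelfAdjoint B) (φ : H) (x y : ℝ) :
    ‖⟪wave A B J x φ, wave A B (G * D + C₂) y φ⟫_ℂ‖ₑ ≤
      ‖ContinuousLinearMap.adjoint G (expI A (x - y) (J (expI B (-x) φ)))‖ₑ *
          ‖D (expI B (-y) φ)‖ₑ + ‖J‖ₑ * ‖φ‖ₑ * ‖C₂ (expI B (-y) φ)‖ₑ := by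
  have hU := isUnitaryGroupOf_expI hA
  have hbound : ‖expI A (x - y) (J (expI B (-x) φ))‖ₑ ≤ ‖J‖ₑ * ‖φ‖ₑ := by
    rw [enorm_eq_iff_norm_eq.2 (hU.norm_apply (x - y) _),
      ← enorm_eq_iff_norm_eq.2 ((isUnitaryGroupOf_expI hB).norm_apply (-x) φ)]
    exact J.le_opENorm _
  have hinner : ⟪wave A B J x φ, wave A B (G * D + C₂) y φ⟫_ℂ =
      ⟪ContinuousLinearMap.adjoint G (expI A (x - y) (J (expI B (-x) φ))),
          D (expI B (-y) φ)⟫_ℂ +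
        ⟪expI A (x - y) (J (expI B (-x) φ)), C₂ (expI B (-y) φ)⟫_ℂ := by
    rw [ContinuousLinearMap.adjoint_inner_left, ← inner_add_right, sub_eq_neg_add, hU.apply_add,
      hU.inner_apply_left, neg_neg]
    rfl
  rw [hinner]
  refine (enorm_add_le _ _).trans (add_le_add (enorm_inner_le_enorm_mul_enorm _ _) ?_)
  exact (enorm_inner_le_enorm_mul_enorm _ _).trans (by gcongr)

theorem lintegral_enorm_inner_wave_le (hA : IsSelfAdjoint A) (hB : IsSelfAdjoint B) {φ : H}
    {P : ℝ≥0∞} (hP : ∀ δ, ∫⁻ v,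
      ‖ContinuousLinearMap.adjoint G (expI A δ (J (expI B (-v) φ)))‖ₑ ^ 2 ≤ P)
    {s y : ℝ} (hy : s ≤ y) (x : ℝ) :
    ∫⁻ a in Ioi 0, ‖⟪wave A B J (x + a) φ, wave A B (G * D + C₂) (y + a) φ⟫_ℂ‖ₑ ≤
      P ^ (1 / 2 : ℝ) * (∫⁻ v in Ioi s, ‖D (expI B (-v) φ)‖ₑ ^ 2) ^ (1 / 2 : ℝ) +
        ‖J‖ₑ * ‖φ‖ₑ * ∫⁻ v in Ioi s, ‖C₂ (expI B (-v) φ)‖ₑ := by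
  have hu := continuous_expI_neg hB φ
  let f := fun v => ‖ContinuousLinearMap.adjoint G (expI A (x - y) (J (expI B (-v) φ)))‖ₑ
  let g := fun v => ‖D (expI B (-v) φ)‖ₑ
  let r := fun v => ‖C₂ (expI B (-v) φ)‖ₑ
  have hf : Measurable fun a => f (x + a) := Continuous.measurable (by fun_prop)
  have hg : Measurable fun a => g (y + a) := Continuous.measurable (by fun_prop)
  have hf2 : ∫⁻ a in Ioi 0, f (x + a) ^ 2 ≤ P := by
    rw [setLIntegral_Ioi_comp_add_left (fun v => f v ^ 2)]
    exact (setLIntegral_le_lintegral _ _).trans (hP _)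
  have htail : ∀ k : ℝ → ℝ≥0∞, ∫⁻ a in Ioi 0, k (y + a) ≤ ∫⁻ v in Ioi s, k v := fun k => by
    rw [setLIntegral_Ioi_comp_add_left, add_zero]
    exact lintegral_mono_set (Ioi_subset_Ioi hy)
  calc ∫⁻ a in Ioi 0, ‖⟪wave A B J (x + a) φ, wave A B (G * D + C₂) (y + a) φ⟫_ℂ‖ₑ
      ≤ ∫⁻ a in Ioi 0, (f (x + a) * g (y + a) + ‖J‖ₑ * ‖φ‖ₑ * r (y + a)) :=
        lintegral_mono fun a => by
          simpa only [add_sub_add_right_eq_sub] using enorm_inner_wave_le hA hB φ (x + a) (y + a)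
    _ = (∫⁻ a in Ioi 0, f (x + a) * g (y + a)) + ‖J‖ₑ * ‖φ‖ₑ * ∫⁻ a in Ioi 0, r (y + a) := by
        rw [lintegral_add_left (hf.fun_mul hg), lintegral_const_mul' _ _ (by finiteness)]
    _ ≤ P ^ (1 / 2 : ℝ) * (∫⁻ v in Ioi s, g v ^ 2) ^ (1 / 2 : ℝ) +
          ‖J‖ₑ * ‖φ‖ₑ * ∫⁻ v in Ioi s, r v := by
        refine add_le_add ?_ (mul_le_mul_right (htail r) _)
        refine (lintegral_mul_le_sqrt_mul_sqrt hf.aemeasurable hg.aemeasurable).trans ?_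
        have hg2 := htail fun v => g v ^ 2
        gcongr ?_ ^ _ * ?_ ^ _

theorem exists_tendsto_wave_of_lintegral_le (hA : IsSelfAdjoint A) (hB : IsSelfAdjoint B)
    (hC : ∀ (φ : A.domain) (ψ : B.domain),
      ⟪(φ : H), (G * D + C₂) (ψ : H)⟫_ℂ = ⟪A φ, J (ψ : H)⟫_ℂ - ⟪(φ : H), J (B ψ)⟫_ℂ)
    {φ : H} {P : ℝ≥0∞} (hPfin : P ≠ ∞) (hP : ∀ δ, ∫⁻ v,
      ‖ContinuousLinearMap.adjoint G (expI A δ (J (expI B (-v) φ)))‖ₑ ^ 2 ≤ P)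
    (hD : ∫⁻ v in Ioi 0, ‖D (expI B (-v) φ)‖ₑ ^ 2 ≠ ∞)
    (hC₂ : ∫⁻ v in Ioi 0, ‖C₂ (expI B (-v) φ)‖ₑ ≠ ∞) :
    ∃ z, Tendsto (fun t => wave A B J t φ) atTop (𝓝 z) := by
  have hu := continuous_expI_neg hB φ
  have hderiv := hasDerivAt_wave hA hB hC φ
  have hcont : Continuous fun t => Complex.I • wave A B (G * D + C₂) t φ :=
    (continuous_wave hA hB φ).const_smul _
  have henorm_I : ‖Complex.I‖ₑ = 1 := by rw [← ofReal_norm, Complex.norm_I, ENNReal.ofReal_one]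
  have hdiff : ∀ d, Tendsto (fun t => wave A B J (d + t) φ - wave A B J t φ) atTop (𝓝 0) := by
    refine tendsto_sub_of_enorm_deriv_le (p := fun v => ‖G‖ₑ * ‖D (expI B (-v) φ)‖ₑ)
      hderiv hcont (Measurable.const_mul (Continuous.measurable (by fun_prop)) _)
      (fun t => ?_) ?_ hC₂
    · rw [enorm_smul, henorm_I, one_mul]
      exact enorm_wave_apply_le hA t φ
    · simp only [mul_pow]
      rw [lintegral_const_mul' _ _ (by finiteness)]
      finiteness
  have hβ : Tendsto (fun s =>
      P ^ (1 / 2 : ℝ) * (∫⁻ v in Ioi s, ‖D (expI B (-v) φ)‖ₑ ^ 2) ^ (1 / 2 : ℝ) +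
        ‖J‖ₑ * ‖φ‖ₑ * ∫⁻ v in Ioi s, ‖C₂ (expI B (-v) φ)‖ₑ) atTop (𝓝 0) := by
    simpa using (ENNReal.Tendsto.const_mul
      ((tendsto_setLIntegral_Ioi_atTop hD).ennrpow_const (1 / 2))
      (Or.inr (by finiteness : P ^ (1 / 2 : ℝ) ≠ ∞))).add
        (ENNReal.Tendsto.const_mul (tendsto_setLIntegral_Ioi_atTop hC₂)
          (Or.inr (by finiteness : ‖J‖ₑ * ‖φ‖ₑ ≠ ∞)))
  refine exists_tendsto_of_lintegral_inner_le hderiv hcont hdiff hβ fun s x _ y hy => ?_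
  simpa only [inner_smul_right, enorm_mul, henorm_I, one_mul] using
    lintegral_enorm_inner_wave_le hA hB hP hy x

theorem exists_tendsto_wave (hA : IsSelfAdjoint A) (hB : IsSelfAdjoint B) {C₁ : H →L[ℂ] H}
    (hC : ∀ (φ : A.domain) (ψ : B.domain),
      ⟪(φ : H), (C₁ + C₂) (ψ : H)⟫_ℂ = ⟪A φ, J (ψ : H)⟫_ℂ - ⟪(φ : H), J (B ψ)⟫_ℂ)
    (hC₁ : IsTraceClass C₁) {φ : H} (hφ : φ ∈ boundedDensitySet B)
    (hint : IntegrableOn (fun t => ‖C₂ (expI B (-t) φ)‖) (Ioi 0)) :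
    ∃ z, Tendsto (fun t => wave A B J t φ) atTop (𝓝 z) := by
  obtain ⟨G, D, w, b, rfl, hD, hDb, hGb⟩ := hC₁.exists_eq_mul
  obtain ⟨c, hc⟩ := exists_lintegral_inner_expI_sq_le hB hφ
  have hu := continuous_expI_neg hB φ
  refine exists_tendsto_wave_of_lintegral_le hA hB hC
    (P := c * ‖J‖ₑ ^ 2 * ∑' i, ‖G (b i)‖ₑ ^ 2) (by finiteness) (fun δ => ?_) ?_
    (by simpa using hint.2.ne)
  · refine lintegral_enorm_adjoint_sq_le b hGb (Continuous.aestronglyMeasurable (by fun_prop))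
      fun η => (lintegral_inner_apply_sq_le hc (expI A δ * J) η).trans ?_
    gcongr
    refine enorm_le_iff_norm_le.2 (ContinuousLinearMap.opNorm_le_bound _ (norm_nonneg _)
      fun x => ?_)
    rw [mul_apply_eq_comp, (isUnitaryGroupOf_expI hA).norm_apply]
    exact J.le_opNorm x
  · have hle := lintegral_enorm_adjoint_sq_le b hDb hu.aestronglyMeasurable hc
    rw [hD] at hle
    exact ne_top_of_le_ne_top (by finiteness) ((setLIntegral_le_lintegral _ _).trans hle)

end Wave

section AbsolutelyContinuousVectors

variable {H : Type*} [NormedAddCommGroup H] [InnerProductSpace ℂ H] [CompleteSpace H]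

namespace ProjMeasure

variable (E : ProjMeasure H) {S : Set ℝ}

theorem enorm_sub_proj_sq (hS : MeasurableSet S) (φ : H) :
    ‖φ - E.proj S φ‖ₑ ^ 2 = E.scalar φ Sᶜ := by
  have hsum : φ = E.proj S φ + E.proj Sᶜ φ := by
    rw [← add_apply, ← E.proj_union hS hS.compl disjoint_compl_right, union_compl_self, E.univ,
      one_apply_eq_self]
  rw [E.scalar_apply_eq_enorm_sq φ hS.compl, ← eq_sub_of_add_eq' hsum.symm]

theorem scalar_proj (hS : MeasurableSet S) (φ : H) :
    E.scalar (E.proj S φ) = (E.scalar φ).restrict S := by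
  rw [← E.calculus_op_indicator hS, E.scalar_op (.indicator_one hS),
    ← withDensity_indicator_one hS]
  congr 1
  ext x
  by_cases hx : x ∈ S <;> simp [hx]

theorem tendsto_proj_of_scalar_iInter_compl_eq_zero {T : ℕ → Set ℝ}
    (hT : ∀ n, MeasurableSet (T n)) (hmono : Monotone T) {φ : H}
    (hzero : E.scalar φ (⋂ n, (T n)ᶜ) = 0) :
    Tendsto (fun n => E.proj (T n) φ) atTop (𝓝 φ) := by
  have hlim := tendsto_measure_iInter_atTop (μ := E.scalar φ)
    (fun n => (hT n).compl.nullMeasurableSet) (fun m n hmn => compl_subset_compl.2 (hmono hmn))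
    ⟨0, measure_ne_top _ _⟩
  rw [hzero] at hlim
  have hsqrt := hlim.ennrpow_const 2⁻¹
  rw [ENNReal.zero_rpow_of_pos (by norm_num)] at hsqrt
  rw [tendsto_iff_edist_tendsto_0]
  refine hsqrt.congr fun n => ?_
  rw [Function.comp_apply, edist_comm, edist_eq_enorm_sub, ← E.enorm_sub_proj_sq (hT n),
    ← ENNReal.rpow_two, ENNReal.rpow_rpow_inv two_ne_zero]

end ProjMeasure

theorem exists_memLp_top_enorm_sq_eq {X : Type*} [MeasurableSpace X] {ν : Measure X}
    {ρ : X → ℝ≥0∞} (hρ : Measurable ρ) {c : NNReal} (hc : ∀ x, ρ x ≤ c) :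
    ∃ f : X → ℂ, MemLp f ∞ ν ∧ ∀ x, ‖f x‖ₑ ^ 2 = ρ x := by
  have hsq : ∀ x, ‖(√(ρ x).toReal : ℂ)‖ₑ ^ 2 = ρ x := fun x => by
    rw [← ofReal_norm, Complex.norm_real, Real.norm_of_nonneg (Real.sqrt_nonneg _),
      ← ENNReal.ofReal_pow (Real.sqrt_nonneg _), Real.sq_sqrt ENNReal.toReal_nonneg,
      ENNReal.ofReal_toReal ((hc x).trans_lt ENNReal.coe_lt_top).ne]
  refine ⟨fun x => (√(ρ x).toReal : ℂ), memLp_top_of_bound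
    (Complex.measurable_ofReal.comp hρ.ennreal_toReal.sqrt).aestronglyMeasurable (√c)
    (ae_of_all _ fun x => ?_), hsq⟩
  rw [Complex.norm_real, Real.norm_of_nonneg (Real.sqrt_nonneg _)]
  exact Real.sqrt_le_sqrt (ENNReal.toReal_le_coe_of_le_coe (hc x))

theorem proj_mem_boundedDensitySet (B : H →ₗ.[ℂ] H) {φ : H} {ρ : ℝ → ℝ≥0∞} (hρ : Measurable ρ)
    (hφ : (spectralMeasure B).scalar φ = volume.withDensity ρ) (c : NNReal) :
    (spectralMeasure B).proj {x | ρ x ≤ c} φ ∈ boundedDensitySet B := by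
  have hS : MeasurableSet {x | ρ x ≤ c} := measurableSet_le hρ measurable_const
  obtain ⟨f, hf, hsq⟩ := exists_memLp_top_enorm_sq_eq (ν := volume) (hρ.indicator hS)
    (indicator_le' (fun _ hx => hx) fun _ _ => zero_le)
  refine ⟨f, hf, ?_⟩
  simp only [hsq]
  rw [ProjMeasure.scalar_proj _ hS, hφ, restrict_withDensity hS, withDensity_indicator hS]

theorem acSubspace_subset_closure (B : H →ₗ.[ℂ] H) :
    (acSubspace B : Set H) ⊆ closure (boundedDensitySet B) := by
  intro φ (hac : (spectralMeasure B).scalar φ ≪ volume)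
  set ρ := ((spectralMeasure B).scalar φ).rnDeriv volume
  have hρ : Measurable ρ := Measure.measurable_rnDeriv _ _
  let S : ℕ → Set ℝ := fun n => {x | ρ x ≤ (n : NNReal)}
  have hnull : volume (⋂ n, (S n)ᶜ) = 0 := by
    refine measure_mono_null (fun x hx => ?_)
      (Measure.rnDeriv_lt_top ((spectralMeasure B).scalar φ) volume)
    rintro (hlt : ρ x < ∞)
    obtain ⟨n, hn⟩ := ENNReal.exists_nat_gt hlt.ne
    exact mem_iInter.1 hx n hn.le
  refine mem_closure_of_tendsto (ProjMeasure.tendsto_proj_of_scalar_iInter_compl_eq_zero _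
    (fun n => measurableSet_le hρ measurable_const)
    (fun m n hmn x (hx : ρ x ≤ (m : NNReal)) => hx.trans (by exact_mod_cast hmn)) (hac hnull))
    (Eventually.of_forall fun n => proj_mem_boundedDensitySet B hρ
      (Measure.withDensity_rnDeriv_eq _ _ hac).symm n)

end AbsolutelyContinuousVectors

section StrongLimit

theorem exists_tendsto_of_mem_closure {ι X α : Type*} [TopologicalSpace X] [UniformSpace α]
    [CompleteSpace α] {l : Filter ι} [NeBot l] {F : ι → X → α} {x : X} {M : Set X}
    (hF : EquicontinuousAt F x) (hx : x ∈ closure M)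
    (hM : ∀ y ∈ M, ∃ z, Tendsto (fun i => F i y) l (𝓝 z)) :
    ∃ z, Tendsto (fun i => F i x) l (𝓝 z) := by
  refine cauchy_map_iff_exists_tendsto.1 (cauchy_map_iff'.2 fun V hV => ?_)
  obtain ⟨W, hW, hWsymm, hWV⟩ := comp_comp_symm_mem_uniformity_sets hV
  obtain ⟨y, hyM, hy⟩ := ((mem_closure_iff_frequently.1 hx).and_eventually (hF W hW)).exists
  obtain ⟨z, hz⟩ := hM y hyM
  have hcauchy : ∀ᶠ p : ι × ι in l ×ˢ l, (F p.1 y, F p.2 y) ∈ W :=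
    cauchy_map_iff'.1 hz.cauchy_map hW
  refine hcauchy.mono fun p hp => ?_
  exact hWV ⟨F p.2 y, ⟨F p.1 y, hy p.1, hp⟩, SetRel.symm W (hy p.2)⟩

theorem exists_continuousLinearMap_tendsto {𝕜 ι E F : Type*} [NontriviallyNormedField 𝕜]
    [NormedAddCommGroup E] [NormedSpace 𝕜 E] [CompleteSpace E] [NormedAddCommGroup F]
    [NormedSpace 𝕜 F] {l : Filter ι} [NeBot l] [l.IsCountablyGenerated] {W : ι → E →L[𝕜] F}
    (h : ∀ φ, ∃ z, Tendsto (fun i => W i φ) l (𝓝 z)) :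
    ∃ Ω : E →L[𝕜] F, ∀ φ, Tendsto (fun i => W i φ) l (𝓝 (Ω φ)) := by
  choose Ω hΩ using h
  exact ⟨continuousLinearMapOfTendsto W (tendsto_pi_nhds.2 hΩ), hΩ⟩

variable {H : Type*} [NormedAddCommGroup H] [InnerProductSpace ℂ H] [CompleteSpace H]

theorem equicontinuous_wave {A B : H →ₗ.[ℂ] H} (hA : IsSelfAdjoint A) (hB : IsSelfAdjoint B)
    (J : H →L[ℂ] H) : Equicontinuous fun t φ => wave A B J t φ :=
  (LipschitzWith.uniformEquicontinuous _ _ fun t =>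
    AddMonoidHomClass.lipschitz_of_bound (wave A B J t) ‖J‖
      (norm_wave_apply_le hA hB t)).equicontinuous

end StrongLimit

end Scattering

end

theorem mainTheorem6 {H : Type*} [NormedAddCommGroup H] [InnerProductSpace ℂ H] [CompleteSpace H]
    (A B : H →ₗ.[ℂ] H) (hA : IsSelfAdjoint A) (hB : IsSelfAdjoint B)
    (J C C₁ C₂ : H →L[ℂ] H)
    (hC : ∀ (φ : A.domain) (ψ : B.domain),
      inner ℂ (φ : H) (C (ψ : H)) = inner ℂ (A φ) (J (ψ : H)) - inner ℂ (φ : H) (J (B ψ)))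
    (hsplit : C = C₁ + C₂)
    (hC₁ : Scattering.IsTraceClass C₁)
    (M : Set H) (hM : M ⊆ Scattering.boundedDensitySet B)
    (hMdense : Scattering.boundedDensitySet B ⊆ closure M)
    (hlim : ∀ φ ∈ M,
      Filter.Tendsto (fun t : ℝ => C₂ (Scattering.expI B (-t) φ)) Filter.atTop (nhds 0))
    (hint : ∀ φ ∈ M,
      MeasureTheory.IntegrableOn (fun t : ℝ => ‖C₂ (Scattering.expI B (-t) φ)‖) (Set.Ioi 0)) :
    ∃ Ω : H →L[ℂ] H, ∀ φ : H,
      Filter.Tendsto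
        (fun t : ℝ => Scattering.expI A t (J (Scattering.expI B (-t) (Scattering.acProj B φ))))
        Filter.atTop (nhds (Ω φ)) := by
  subst hsplit
  refine Scattering.exists_continuousLinearMap_tendsto
    (W := fun t => Scattering.wave A B J t * Scattering.acProj B) fun φ => ?_
  have hac : Scattering.acProj B φ ∈ closure M :=
    closure_minimal hMdense isClosed_closure
      (Scattering.acSubspace_subset_closure B (Submodule.starProjection_apply_mem _ φ))
  exact Scattering.exists_tendsto_of_mem_closure (F := fun t ψ => Scattering.wave A B J t ψ)
    (Scattering.equicontinuous_wave hA hB J _) hac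
    fun ψ hψ => Scattering.exists_tendsto_wave hA hB hC hC₁ (hM hψ) (hint ψ hψ)
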